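/- **Setting.** All Hilbert spaces are complex, inner products are linear in the first argument, and $\mathcal H^*$ denotes the anti-dual (bounded conjugate-linear functionals) of a Hilbert space $\mathcal H$, with linear Riesz isomorphism $\mathcal R_{\mathcal H}:\mathcal H\to\mathcal H^*$. Let $\mathcal X,\mathcal Y$ be Hilbert spaces. Let $A:\mathcal X\supset\operatorname{dom}A\to\mathcal Y$ be closed and densely defined such that $S=A^*A$ is uniformly positive, i.e. there is $c>0$ with $\langle x,Sx\rangle\ge c\|x\|^2$ for all $x\in\operatorname{dom}S$. Let $B:\mathcal Y\supset\operatorname{dom}B\to\mathcal X$ be closed and densely defined with $A^*\subset -B$. Let $\mathcal X_h=\operatorname{dom}A$ with inner product $\langle Ax,Ay\rangle_{\mathcal Y}$ (a Hilbert space), let $\mathcal Z_h=\mathcal X_h\times\mathcal X$, and define on $\mathcal Z_h$ $$\operatorname{dom}\mathcal A=\{(z_1,z_2)\in\mathcal X_h\times\mathcal X_h : Az_1\in\operatorname{dom}B\},\qquad \mathcal A(z_1,z_2)=(z_2,\,BAz_1),\qquad \mathcal A_0:=\mathcal A^*.$$ Let $\mathcal G_1,\mathcal G_2$ be Hilbert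 spaces and let $\Lambda=(\Lambda_1,\Lambda_2):\operatorname{dom}A\to\mathcal G_1\times\mathcal G_2^*$ and $\Pi=(\Pi_1,\Pi_2):\operatorname{dom}B\to\mathcal G_1^*\times\mathcal G_2$ be linear and surjective with $$-\langle By,x\rangle_{\mathcal X}-\langle y,Ax\rangle_{\mathcal Y}=\langle\Pi_1y,\Lambda_1x\rangle_{\mathcal G_1^*,\mathcal G_1}-\langle\Pi_2y,\Lambda_2x\rangle_{\mathcal G_2,\mathcal G_2^*}\qquad(x\in\operatorname{dom}A,\ y\in\operatorname{dom}B).$$ Put $\mathcal G=\mathcal G_1\times\mathcal G_2$, identify $\mathcal G^*=\mathcal G_1^*\times\mathcal G_2^*$, and for $z=(z_1,z_2)\in\operatorname{dom}\mathcal A$ let $\Gamma_0z=(\Lambda_1z_2,\Pi_2Az_1)\in\mathcal G$ and $\Gamma_1z=(-\Pi_1Az_1,\Lambda_2z_2)\in\mathcal G^*$. **Definitions.** A colligation consists of linear maps $G,L,K$ on a common domain $\mathcal Z$ in the state space, with values in the input space, the state space and the output space. It is a *boundary node* if the combined operator $(G,L,K)$ is closed, $G$ is surjective, $\ker G$ is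 dense in the state space, and $L|_{\ker G}$ has non-empty resolvent set; it is *internally well-posed* if moreover $L|_{\ker G}$ generates a strongly continuous semigroup. A *smooth solution* consists of $u\in C^2$, of $z$ that is $C^1$ in the state space and continuous in $\mathcal Z$ with the graph norm of $(G,L,K)$, and of $y$, with $u=Gz$, $\dot z=Lz$, $y=Kz$ on $[0,\infty)$. An internally well-posed boundary node is *scattering passive* if all smooth solutions satisfy $\frac{d}{dt}\|z(t)\|^2+\|y(t)\|^2\le\|u(t)\|^2$ for all $t\ge0$, and *scattering energy-preserving* if they satisfy this with equality. **Theorem.** We have $\mathcal A_0^*=\mathcal A$. Let $P\in L(\mathcal G^*)$ and let $N$ be the colligation with domain $\operatorname{dom}\mathcal A_0^*$, input and output space $\mathcal G^*$, state space $\mathcal Z_h$, input operator $\tfrac1{\sqrt2}(\mathcal R_{\mathcal G}\Gamma_0+\Gamma_1)$, interior operator $\mathcal A_0^*$ and output operator $-\tfrac1{\sqrt2}P(\mathcal R_{\mathcal G}\Gamma_0-\Gamma_1)$. Then 1. $N$ is a scattering passive boundary node if and only if $\|P\|\le1$. 2. $N$ is a scattering energy-preserving boundary node if and only if $P$ is norm-preserving,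 i.e. $\|Pg\|=\|g\|$ for all $g\in\mathcal G^*$. 3. $P$ is unitary if and only if $N$ is a scattering energy-preserving boundary node and $P$ is surjective. In particular, if $\mathcal G$ is finite-dimensional, then $N$ is a scattering energy-preserving boundary node if and only if $P$ is unitary. -/

import Mathlib

open Set Filter Topology
open scoped ComplexConjugate InnerProductSpace

noncomputable section

/-! ### Anti-duals of Hilbert spaces

All Hilbert spaces are complex.  Mathlib's `inner ℂ x y` is conjugate linear in `x`; an inner
product `⟨x, y⟩` that is linear in its first argument is therefore `inner ℂ y x`. -/

/-- The anti-dual: bounded conjugate linear functionals, with the operator norm.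
The pairing `⟨f, x⟩` of `f` in the anti-dual with `x` is `f x`, and `⟨x, f⟩ = conj (f x)`. -/
abbrev AntiDual (E : Type*) [NormedAddCommGroup E] [InnerProductSpace ℂ E] : Type _ :=
  E →L⋆[ℂ] ℂ

/-- The linear Riesz isomorphism of a Hilbert space onto its anti-dual,
`x ↦ (y ↦ inner ℂ y x)`. -/
def rieszIso (E : Type*) [NormedAddCommGroup E] [InnerProductSpace ℂ E] [CompleteSpace E] :
    E ≃ₗᵢ[ℂ] AntiDual E :=
  LinearIsometryEquiv.ofSurjective
    { toLinearMap := (innerSLFlip ℂ (E := E)).toLinearMap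
      norm_map' := fun x => by
        apply le_antisymm
        · refine ContinuousLinearMap.opNorm_le_bound _ (norm_nonneg x) fun y => ?_
          simpa [mul_comm] using norm_inner_le_norm (𝕜 := ℂ) y x
        · rcases eq_or_ne x 0 with rfl | hx
          · simp
          · have h := ContinuousLinearMap.le_opNorm (innerSLFlip ℂ x) x
            have h2 : ‖(innerSLFlip ℂ x) x‖ = ‖x‖ * ‖x‖ := by
              simp [inner_self_eq_norm_sq_to_K, sq]
            rw [h2] at h
            exact le_of_mul_le_mul_right h (norm_pos_iff.2 hx) }
    (fun f => by
      let g : StrongDual ℂ E := (starL ℂ (A := ℂ) : ℂ →L⋆[ℂ] ℂ).comp f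
      refine ⟨(InnerProductSpace.toDual ℂ E).symm g, ?_⟩
      ext y
      have h : inner ℂ ((InnerProductSpace.toDual ℂ E).symm g) y = g y :=
        InnerProductSpace.toDual_symm_apply
      change inner ℂ y ((InnerProductSpace.toDual ℂ E).symm g) = f y
      rw [← inner_conj_symm, h]
      simp [g])

theorem rieszIso_apply {E : Type*} [NormedAddCommGroup E] [InnerProductSpace ℂ E]
    [CompleteSpace E] (x y : E) : rieszIso E x y = inner ℂ y x := rfl

/-- The anti-dual is a Hilbert space; its inner product is transported by the Riesz isomorphism,
and its norm is the operator norm. -/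
instance AntiDual.instInnerProductSpace (E : Type*) [NormedAddCommGroup E]
    [InnerProductSpace ℂ E] [CompleteSpace E] : InnerProductSpace ℂ (AntiDual E) :=
  { (inferInstance : NormedSpace ℂ (AntiDual E)) with
    inner := fun f g => inner ℂ ((rieszIso E).symm f) ((rieszIso E).symm g)
    norm_sq_eq_re_inner := fun f => by
      rw [inner_self_eq_norm_sq, LinearIsometryEquiv.norm_map]
    conj_inner_symm := fun f g => by simp
    add_left := fun f g h => by simp
    smul_left := fun f g r => by simp [mul_comm] }

/-- The canonical identification of `E* × F*` with the anti-dual of the Hilbert sum `E × F`: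
`⟨(f, g), (x, y)⟩ = ⟨f, x⟩ + ⟨g, y⟩`. -/
def antiDualProd {E F : Type*} [NormedAddCommGroup E] [InnerProductSpace ℂ E]
    [NormedAddCommGroup F] [InnerProductSpace ℂ F] :
    (AntiDual E × AntiDual F) →ₗ[ℂ] AntiDual (WithLp 2 (E × F)) where
  toFun p := p.1.comp (WithLp.fstL 2 ℂ E F) + p.2.comp (WithLp.sndL 2 ℂ E F)
  map_add' p q := by
    ext x
    simp
    ring
  map_smul' c p := by
    ext x
    simp

theorem antiDualProd_apply {E F : Type*} [NormedAddCommGroup E] [InnerProductSpace ℂ E]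
    [NormedAddCommGroup F] [InnerProductSpace ℂ F] (f : AntiDual E) (g : AntiDual F)
    (x : WithLp 2 (E × F)) : antiDualProd (f, g) x = f x.fst + g x.snd := rfl

/-! ### Semigroups, resolvent sets, boundary nodes -/

/-- A strongly continuous one-parameter semigroup `(T t)`, `t ≥ 0`, of bounded operators
(values at negative `t` are irrelevant). -/
structure IsC0Semigroup {X : Type*} [NormedAddCommGroup X] [InnerProductSpace ℂ X]
    (T : ℝ → X →L[ℂ] X) : Prop where
  map_zero : T 0 = 1
  map_add : ∀ s t : ℝ, 0 ≤ s → 0 ≤ t → T (s + t) = (T s).comp (T t)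
  continuousOn : ∀ x : X, ContinuousOn (fun t => T t x) (Ici 0)

/-- `A` is the generator of a strongly continuous semigroup `T`: `x` lies in the domain of `A`
and `A x = y` if and only if `(T t x - x) / t → y` as `t ↓ 0`. -/
def LinearPMap.GeneratesC0Semigroup {X : Type*} [NormedAddCommGroup X] [InnerProductSpace ℂ X]
    (A : X →ₗ.[ℂ] X) : Prop :=
  ∃ T : ℝ → X →L[ℂ] X, IsC0Semigroup T ∧
    ∀ x y : X, (x, y) ∈ A.graph ↔
      Tendsto (fun t : ℝ => t⁻¹ • (T t x - x)) (𝓝[>] 0) (𝓝 y)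

/-- The resolvent set: all `μ` for which `μ - A : dom A → X` has a bounded everywhere defined
inverse `R`. -/
def LinearPMap.pmapResolventSet {X : Type*} [NormedAddCommGroup X] [InnerProductSpace ℂ X]
    (A : X →ₗ.[ℂ] X) : Set ℂ :=
  {μ | ∃ R : X →L[ℂ] X,
    (∀ x : X, ∃ h : R x ∈ A.domain, μ • R x - A ⟨R x, h⟩ = x) ∧
    (∀ x : A.domain, R (μ • (x : X) - A x) = x)}

/-- A colligation: three linear maps with a common domain `dom` in the state space `X`, with
values in the input space `U`, the state space `X` and the output space `Y`. -/
structure Colligation (U X Y : Type*) [NormedAddCommGroup U] [InnerProductSpace ℂ U]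
    [NormedAddCommGroup X] [InnerProductSpace ℂ X]
    [NormedAddCommGroup Y] [InnerProductSpace ℂ Y] where
  dom : Submodule ℂ X
  G : dom →ₗ[ℂ] U
  L : dom →ₗ[ℂ] X
  K : dom →ₗ[ℂ] Y

namespace Colligation

variable {U X Y : Type*} [NormedAddCommGroup U] [InnerProductSpace ℂ U]
  [NormedAddCommGroup X] [InnerProductSpace ℂ X]
  [NormedAddCommGroup Y] [InnerProductSpace ℂ Y]

/-- The combined operator `z ↦ (G z, L z, K z)`. -/
def combined (Θ : Colligation U X Y) : X →ₗ.[ℂ] (U × X × Y) where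
  domain := Θ.dom
  toFun := Θ.G.prod (Θ.L.prod Θ.K)

/-- The kernel of the input boundary operator, as a subspace of the state space. -/
def kerG (Θ : Colligation U X Y) : Submodule ℂ X :=
  (LinearMap.ker Θ.G).map Θ.dom.subtype

/-- The main operator: the restriction of `L` to `ker G`. -/
def mainOperator (Θ : Colligation U X Y) : X →ₗ.[ℂ] X :=
  (LinearPMap.mk Θ.dom Θ.L).domRestrict Θ.kerG

/-- Boundary nodes. -/
structure IsBoundaryNode (Θ : Colligation U X Y) : Prop where
  closed : Θ.combined.IsClosed
  surjective : Function.Surjective Θ.G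
  dense_ker : Dense (Θ.kerG : Set X)
  resolvent_nonempty : Θ.mainOperator.pmapResolventSet.Nonempty

/-- Internally well-posed boundary nodes. -/
def IsInternallyWellPosed (Θ : Colligation U X Y) : Prop :=
  Θ.IsBoundaryNode ∧ Θ.mainOperator.GeneratesC0Semigroup

/-- Smooth solutions on `[0, ∞)` of `u = G z`, `z' = L z`, `y = K z`: the input is twice
continuously differentiable, `z` is continuously differentiable in `X` and continuous in the
solution space `dom` with the graph norm of the combined operator.  Only times `t ≥ 0` matter. -/
structure IsSmoothSolution (Θ : Colligation U X Y) (u : ℝ → U) (z : ℝ → Θ.dom) (y : ℝ → Y) :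
    Prop where
  input_contDiff : ContDiffOn ℝ 2 u (Ici 0)
  state_contDiff : ContDiffOn ℝ 1 (fun t => (z t : X)) (Ici 0)
  state_continuous : ContinuousOn (fun t => ((z t : X), Θ.G (z t), Θ.L (z t), Θ.K (z t))) (Ici 0)
  input_eq : ∀ t, 0 ≤ t → u t = Θ.G (z t)
  state_eq : ∀ t, 0 ≤ t → HasDerivWithinAt (fun s => (z s : X)) (Θ.L (z t)) (Ici 0) t
  output_eq : ∀ t, 0 ≤ t → y t = Θ.K (z t)

/-- Scattering passive boundary nodes.  The derivative at `t = 0` is the one-sided one. -/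
def IsScatteringPassive (Θ : Colligation U X Y) : Prop :=
  Θ.IsInternallyWellPosed ∧ ∀ u z y, Θ.IsSmoothSolution u z y → ∀ t, 0 ≤ t →
    derivWithin (fun s => ‖(z s : X)‖ ^ 2) (Ici 0) t + ‖y t‖ ^ 2 ≤ ‖u t‖ ^ 2

/-- Scattering energy-preserving boundary nodes. -/
def IsScatteringEnergyPreserving (Θ : Colligation U X Y) : Prop :=
  Θ.IsInternallyWellPosed ∧ ∀ u z y, Θ.IsSmoothSolution u z y → ∀ t, 0 ≤ t →
    derivWithin (fun s => ‖(z s : X)‖ ^ 2) (Ici 0) t + ‖y t‖ ^ 2 = ‖u t‖ ^ 2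

end Colligation

/-! ### Abstract second order systems -/

/-- The data of the second order system: `A : X ⊃ dom A → Y` closed and densely defined, such
that the self-adjoint operator `S = A* A` is uniformly positive, and `B : Y ⊃ dom B → X` closed and
densely defined such that `(A*, -B*)` is a dual pair, i.e. `A* ⊂ -B`. -/
structure SecondOrderSystem (X Y : Type*) [NormedAddCommGroup X] [InnerProductSpace ℂ X]
    [CompleteSpace X] [NormedAddCommGroup Y] [InnerProductSpace ℂ Y] [CompleteSpace Y] where
  A : X →ₗ.[ℂ] Y
  B : Y →ₗ.[ℂ] X
  A_closed : A.IsClosed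
  A_dense : Dense (A.domain : Set X)
  /-- `⟨x, S x⟩ ≥ c ‖x‖²` for `x` in `dom S = {x ∈ dom A | A x ∈ dom A*}`. -/
  uniformly_positive : ∃ c : ℝ, 0 < c ∧ ∀ (x : A.domain) (h : A x ∈ A.adjoint.domain),
    c * ‖(x : X)‖ ^ 2 ≤ (inner ℂ (x : X) (A.adjoint ⟨A x, h⟩)).re
  B_closed : B.IsClosed
  B_dense : Dense (B.domain : Set Y)
  dualPair : A.adjoint ≤ -B

namespace SecondOrderSystem

variable {X Y : Type*} [NormedAddCommGroup X] [InnerProductSpace ℂ X] [CompleteSpace X]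
  [NormedAddCommGroup Y] [InnerProductSpace ℂ Y] [CompleteSpace Y]

/-- Coercivity of the form `⟨A x, A y⟩` on `dom A`: the domain of `S = A* A` is a core for `A`, so
uniform positivity of `S` extends to all of `dom A`. -/
theorem coercive (D : SecondOrderSystem X Y) :
    ∃ c : ℝ, 0 < c ∧ ∀ x : D.A.domain, c * ‖(x : X)‖ ^ 2 ≤ ‖D.A x‖ ^ 2 := by
  obtain ⟨c, hc, hpos⟩ := D.uniformly_positive
  refine ⟨c, hc, fun x₀ => ?_⟩
  let H := WithLp 2 (X × Y)
  let e : H ≃L[ℂ] X × Y := WithLp.prodContinuousLinearEquiv 2 ℂ X Y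
  -- the graph of `A` as a closed subspace of a Hilbert space
  let Γ : Submodule ℂ H := D.A.graph.comap e.toLinearEquiv.toLinearMap
  have hΓmem : ∀ p : H, p ∈ Γ ↔ ∃ x : D.A.domain, (x : X) = p.fst ∧ D.A x = p.snd := by
    intro p
    exact LinearPMap.mem_graph_iff D.A
  have hΓc : IsClosed (Γ : Set H) := D.A_closed.preimage e.continuous
  have : CompleteSpace Γ := hΓc.completeSpace_coe
  -- the part of the graph over the domain of `A* A`
  let W : Submodule ℂ H := Γ ⊓ D.A.adjoint.domain.comap (WithLp.sndL 2 ℂ X Y).toLinearMap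
  have hWΓ : W.topologicalClosure ≤ Γ :=
    Submodule.topologicalClosure_minimal _ inf_le_left hΓc
  have : CompleteSpace W.topologicalClosure :=
    W.isClosed_topologicalClosure.completeSpace_coe
  have hAfa : ∀ (y : D.A.adjoint.domain) (x : D.A.domain),
      inner ℂ (D.A.adjoint y) (x : X) = inner ℂ (y : Y) (D.A x) :=
    LinearPMap.adjoint_isFormalAdjoint D.A_dense
  have hort : W.topologicalClosureᗮ ⊓ Γ = ⊥ := by
    rw [eq_bot_iff]
    rintro v ⟨hv, hvΓ⟩
    obtain ⟨v₁, hv₁, hv₂⟩ := (hΓmem v).1 hvΓ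
    have hvW : ∀ w ∈ W, inner ℂ w v = 0 := fun w hw =>
      (Submodule.mem_orthogonal _ _).1 hv w (W.le_topologicalClosure hw)
    let q : H := WithLp.toLp 2 ((v₁ : X), (0 : Y))
    let p : H := Γ.starProjection q
    have hpΓ : p ∈ Γ := Submodule.starProjection_apply_mem _ _
    have hqp : ∀ w ∈ Γ, inner ℂ (q - p) w = 0 := fun w hw =>
      Submodule.starProjection_inner_eq_zero q w hw
    obtain ⟨p₁, hp₁, hp₂⟩ := (hΓmem p).1 hpΓ
    have hkey : ∀ x : D.A.domain,
        inner ℂ ((v₁ : X) - p₁) (x : X) = inner ℂ (D.A p₁) (D.A x) := by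
      intro x
      have h := hqp (WithLp.toLp 2 ((x : X), D.A x)) ((hΓmem _).2 ⟨x, rfl, rfl⟩)
      rw [WithLp.prod_inner_apply] at h
      change inner ℂ ((v₁ : X) - p.fst) (x : X) + inner ℂ ((0 : Y) - p.snd) (D.A x) = 0 at h
      rw [← hp₁, ← hp₂, zero_sub, inner_neg_left] at h
      exact add_neg_eq_zero.1 h
    have hmem : D.A p₁ ∈ D.A.adjoint.domain :=
      LinearPMap.mem_adjoint_domain_of_exists _ ⟨_, hkey⟩
    have hpW : p ∈ W := ⟨hpΓ, by
      change p.snd ∈ D.A.adjoint.domain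
      rw [← hp₂]; exact hmem⟩
    have h0 := hvW p hpW
    rw [WithLp.prod_inner_apply] at h0
    change inner ℂ p.fst v.fst + inner ℂ p.snd v.snd = 0 at h0
    rw [← hp₁, ← hp₂, ← hv₁, ← hv₂, ← hkey v₁, ← inner_add_left] at h0
    have hz : v₁ = 0 := by
      simpa using h0
    have hv0 : v = 0 := by
      apply (WithLp.prodContinuousLinearEquiv 2 ℂ X Y).injective
      apply Prod.ext
      · change v.fst = 0
        rw [← hv₁, hz]; rfl
      · change v.snd = 0
        rw [← hv₂, hz]; simp
    simp [hv0]
  have heq : W.topologicalClosure = Γ := by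
    have h := Submodule.sup_orthogonal_inf_of_hasOrthogonalProjection hWΓ
    rwa [hort, sup_bot_eq] at h
  have hcl : IsClosed {p : H | c * ‖p.fst‖ ^ 2 ≤ ‖p.snd‖ ^ 2} := by
    have h1 : Continuous fun p : H => p.fst := (WithLp.fstL 2 ℂ X Y).continuous
    have h2 : Continuous fun p : H => p.snd := (WithLp.sndL 2 ℂ X Y).continuous
    exact isClosed_le (by fun_prop) (by fun_prop)
  have hsub : closure (W : Set H) ⊆ {p : H | c * ‖p.fst‖ ^ 2 ≤ ‖p.snd‖ ^ 2} := by
    refine closure_minimal ?_ hcl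
    rintro p ⟨hpΓ, hpd⟩
    obtain ⟨x, hx₁, hx₂⟩ := (hΓmem p).1 hpΓ
    have hd : D.A x ∈ D.A.adjoint.domain := by rw [hx₂]; exact hpd
    have h := hpos x hd
    have h2 := hAfa ⟨D.A x, hd⟩ x
    rw [← inner_conj_symm, h2, Complex.conj_re] at h
    change c * ‖p.fst‖ ^ 2 ≤ ‖p.snd‖ ^ 2
    rw [← hx₁, ← hx₂]
    simpa [inner_self_eq_norm_sq_to_K, ← Complex.ofReal_pow] using h
  have hx₀ : (WithLp.toLp 2 ((x₀ : X), D.A x₀) : H) ∈ Γ := (hΓmem _).2 ⟨x₀, rfl, rfl⟩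
  rw [← heq] at hx₀
  exact hsub hx₀

/-- The energy space `X_h`: the vector space `dom A`, with inner product `⟨A x, A y⟩`. -/
def EnergySpace (D : SecondOrderSystem X Y) : Type _ := D.A.domain

instance (D : SecondOrderSystem X Y) : AddCommGroup D.EnergySpace :=
  inferInstanceAs (AddCommGroup D.A.domain)

instance (D : SecondOrderSystem X Y) : Module ℂ D.EnergySpace :=
  inferInstanceAs (Module ℂ D.A.domain)

/-- The identity, from the energy space to `dom A` as a subspace of `X`. -/
def toDom (D : SecondOrderSystem X Y) : D.EnergySpace ≃ₗ[ℂ] D.A.domain :=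
  LinearEquiv.refl ℂ D.A.domain

/-- `A` as an operator on the energy space. -/
def energyA (D : SecondOrderSystem X Y) : D.EnergySpace →ₗ[ℂ] Y :=
  D.A.toFun ∘ₗ D.toDom.toLinearMap

theorem energyA_injective (D : SecondOrderSystem X Y) : Function.Injective D.energyA := by
  rw [injective_iff_map_eq_zero]
  intro x hx
  obtain ⟨c, hc, h⟩ := D.coercive
  have h1 := h (D.toDom x)
  have hx' : D.A (D.toDom x) = 0 := hx
  rw [hx', norm_zero, zero_pow two_ne_zero] at h1
  have h2 : ‖(D.toDom x : X)‖ ^ 2 ≤ 0 := nonpos_of_mul_nonpos_right h1 hc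
  have h3 : (D.toDom x : X) = 0 := by
    rw [← norm_eq_zero]
    exact pow_eq_zero_iff two_ne_zero |>.1 (le_antisymm h2 (sq_nonneg _))
  exact D.toDom.map_eq_zero_iff.1 (Subtype.ext h3)

/-- The energy norm `‖x‖ = ‖A x‖`. -/
instance (D : SecondOrderSystem X Y) : NormedAddCommGroup D.EnergySpace :=
  NormedAddCommGroup.induced D.EnergySpace Y D.energyA D.energyA_injective

instance (D : SecondOrderSystem X Y) : InnerProductSpace ℂ D.EnergySpace where
  norm_smul_le c x := by
    change ‖D.energyA (c • x)‖ ≤ ‖c‖ * ‖D.energyA x‖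
    rw [map_smul, norm_smul]
  inner x y := inner ℂ (D.energyA x) (D.energyA y)
  norm_sq_eq_re_inner x := by
    rw [inner_self_eq_norm_sq]
    rfl
  conj_inner_symm x y := inner_conj_symm _ _
  add_left x y z := by simp
  smul_left x y r := by simp [mul_comm]

theorem energy_inner (D : SecondOrderSystem X Y) (x y : D.EnergySpace) :
    inner ℂ x y = inner ℂ (D.A (D.toDom x)) (D.A (D.toDom y)) := rfl

instance (D : SecondOrderSystem X Y) : CompleteSpace D.EnergySpace := by
  have hiso : Isometry D.energyA := AddMonoidHomClass.isometry_of_norm _ fun _ => rfl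
  refine Metric.complete_of_cauchySeq_tendsto fun u hu => ?_
  obtain ⟨y, hy⟩ := cauchySeq_tendsto_of_complete (hiso.uniformContinuous.comp_cauchySeq hu)
  obtain ⟨c, hc, hco⟩ := D.coercive
  have hsc : 0 < √c := Real.sqrt_pos.2 hc
  have hb : ∀ x : D.EnergySpace, ‖(D.toDom x : X)‖ ≤ (√c)⁻¹ * ‖x‖ := by
    intro x
    have h := hco (D.toDom x)
    have h2 : √c * ‖(D.toDom x : X)‖ ≤ ‖x‖ := by
      refine le_of_sq_le_sq ?_ (norm_nonneg x)
      rw [mul_pow, Real.sq_sqrt hc.le]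
      exact h
    rw [inv_mul_eq_div, le_div_iff₀ hsc]
    linarith
  let ι : D.EnergySpace →L[ℂ] X :=
    (D.A.domain.subtype ∘ₗ D.toDom.toLinearMap).mkContinuous _ hb
  obtain ⟨x, hx⟩ := cauchySeq_tendsto_of_complete (ι.uniformContinuous.comp_cauchySeq hu)
  have hg : (x, y) ∈ D.A.graph := by
    refine D.A_closed.mem_of_tendsto (hx.prodMk_nhds hy) (Eventually.of_forall fun n => ?_)
    exact LinearPMap.mem_graph D.A (D.toDom (u n))
  obtain ⟨x', -, hx'⟩ := (LinearPMap.mem_graph_iff D.A).1 hg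
  refine ⟨D.toDom.symm x', ?_⟩
  rw [hiso.isEmbedding.tendsto_nhds_iff]
  have : D.energyA (D.toDom.symm x') = y := hx'
  rw [this]
  exact hy

/-- The state space `Z_h = X_h × X`, a Hilbert sum. -/
abbrev StateSpace (D : SecondOrderSystem X Y) : Type _ := WithLp 2 (D.EnergySpace × X)

/-- `dom 𝒜 = {(z₁, z₂) | z₁ ∈ X_h, z₂ ∈ dom A, A z₁ ∈ dom B}`. -/
def maxDomain (D : SecondOrderSystem X Y) : Submodule ℂ D.StateSpace :=
  D.B.domain.comap (D.energyA ∘ₗ (WithLp.fstL 2 ℂ D.EnergySpace X).toLinearMap) ⊓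
    D.A.domain.comap (WithLp.sndL 2 ℂ D.EnergySpace X).toLinearMap

/-- `z ↦ A z₁`, from `dom 𝒜` to `dom B`. -/
def strain (D : SecondOrderSystem X Y) : D.maxDomain →ₗ[ℂ] D.B.domain :=
  LinearMap.codRestrict D.B.domain
    (D.energyA ∘ₗ (WithLp.fstL 2 ℂ D.EnergySpace X).toLinearMap ∘ₗ D.maxDomain.subtype)
    (fun z => z.2.1)

/-- `z ↦ z₂`, from `dom 𝒜` to `dom A`. -/
def velocity (D : SecondOrderSystem X Y) : D.maxDomain →ₗ[ℂ] D.A.domain :=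
  LinearMap.codRestrict D.A.domain
    ((WithLp.sndL 2 ℂ D.EnergySpace X).toLinearMap ∘ₗ D.maxDomain.subtype)
    (fun z => z.2.2)

/-- The maximal operator `𝒜 (z₁, z₂) = (z₂, B A z₁)` on `dom 𝒜`. -/
def maxOperator (D : SecondOrderSystem X Y) : D.StateSpace →ₗ.[ℂ] D.StateSpace where
  domain := D.maxDomain
  toFun := (WithLp.linearEquiv 2 ℂ (D.EnergySpace × X)).symm.toLinearMap ∘ₗ
    (D.toDom.symm.toLinearMap ∘ₗ D.velocity).prod (D.B.toFun ∘ₗ D.strain)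

/-- The minimal operator `𝒜₀ = 𝒜*`. -/
def minOperator (D : SecondOrderSystem X Y) : D.StateSpace →ₗ.[ℂ] D.StateSpace :=
  D.maxOperator.adjoint

theorem maxOperator_apply (D : SecondOrderSystem X Y) (z : D.maxDomain) :
    D.maxOperator z = WithLp.toLp 2 (D.toDom.symm (D.velocity z), D.B (D.strain z)) := rfl

/-- A boundary triplet `((G₁, G₂), Λ, Π)` for the dual pair `(A*, -B*)`, with
`Λ = (Λ₁, Λ₂) : dom A → G₁ × G₂*` and `Π = (Π₁, Π₂) : dom B → G₁* × G₂` surjective and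
`-⟨B y, x⟩ - ⟨y, A x⟩ = ⟨Π₁ y, Λ₁ x⟩ - ⟨Π₂ y, Λ₂ x⟩`, all pairings being linear in the first
argument. -/
structure BoundaryTriplet (D : SecondOrderSystem X Y) (G₁ G₂ : Type*)
    [NormedAddCommGroup G₁] [InnerProductSpace ℂ G₁]
    [NormedAddCommGroup G₂] [InnerProductSpace ℂ G₂] where
  Λ₁ : D.A.domain →ₗ[ℂ] G₁
  Λ₂ : D.A.domain →ₗ[ℂ] AntiDual G₂
  Pi₁ : D.B.domain →ₗ[ℂ] AntiDual G₁
  Pi₂ : D.B.domain →ₗ[ℂ] G₂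
  surjective_Λ : Function.Surjective fun x => (Λ₁ x, Λ₂ x)
  surjective_Pi : Function.Surjective fun y => (Pi₁ y, Pi₂ y)
  green : ∀ (y : D.B.domain) (x : D.A.domain),
    - inner ℂ (x : X) (D.B y) - inner ℂ (D.A x) (y : Y) =
      Pi₁ y (Λ₁ x) - conj (Λ₂ x (Pi₂ y))

namespace BoundaryTriplet

variable {D : SecondOrderSystem X Y} {G₁ G₂ : Type*}
  [NormedAddCommGroup G₁] [InnerProductSpace ℂ G₁]
  [NormedAddCommGroup G₂] [InnerProductSpace ℂ G₂]

/-- `Γ₀ z = (Λ₁ z₂, Π₂ A z₁)`, with values in `G = G₁ × G₂`. -/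
def Γ₀ (T : D.BoundaryTriplet G₁ G₂) : D.maxDomain →ₗ[ℂ] WithLp 2 (G₁ × G₂) :=
  (WithLp.linearEquiv 2 ℂ (G₁ × G₂)).symm.toLinearMap ∘ₗ
    (T.Λ₁ ∘ₗ D.velocity).prod (T.Pi₂ ∘ₗ D.strain)

/-- `Γ₁ z = (-Π₁ A z₁, Λ₂ z₂)`, with values in `G* = G₁* × G₂*`. -/
def Γ₁ (T : D.BoundaryTriplet G₁ G₂) : D.maxDomain →ₗ[ℂ] AntiDual (WithLp 2 (G₁ × G₂)) :=
  antiDualProd ∘ₗ (-(T.Pi₁ ∘ₗ D.strain)).prod (T.Λ₂ ∘ₗ D.velocity)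

variable [CompleteSpace G₁] [CompleteSpace G₂]

/-- `R Γ₀`, with `R` the Riesz isomorphism of `G = G₁ × G₂` onto its anti-dual. -/
def rieszΓ₀ (T : D.BoundaryTriplet G₁ G₂) : D.maxDomain →ₗ[ℂ] AntiDual (WithLp 2 (G₁ × G₂)) :=
  (rieszIso (WithLp 2 (G₁ × G₂))).toLinearEquiv.toLinearMap ∘ₗ T.Γ₀

/-- The colligation with input `(1/√2) (R Γ₀ + Γ₁)`, interior operator `𝒜` and output
`-(1/√2) P (R Γ₀ - Γ₁)`. -/
def colligation (T : D.BoundaryTriplet G₁ G₂)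
    (P : AntiDual (WithLp 2 (G₁ × G₂)) →L[ℂ] AntiDual (WithLp 2 (G₁ × G₂))) :
    Colligation (AntiDual (WithLp 2 (G₁ × G₂))) D.StateSpace
      (AntiDual (WithLp 2 (G₁ × G₂))) where
  dom := D.maxDomain
  G := (1 / ((√2 : ℝ) : ℂ)) • (T.rieszΓ₀ + T.Γ₁)
  L := D.maxOperator.toFun
  K := (-1 / ((√2 : ℝ) : ℂ)) • (P.toLinearMap ∘ₗ (T.rieszΓ₀ - T.Γ₁))

end BoundaryTriplet

end SecondOrderSystem

end

/-!
Write `M` for the maximal operator, `Gp = (R Γ₀ + Γ₁) / √2` and `Gm = (R Γ₀ - Γ₁) / √2` for the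
incoming and the outgoing wave. By polarization the Green identity becomes
`⟪M z, w⟫ + ⟪z, M w⟫ = ⟪Gp z, Gp w⟫ - ⟪Gm z, Gm w⟫`.

Since the adjoint of `M` is contained in `-M` and `(Gp, Gm)` is jointly onto, the adjoint of the
restriction of `M` to `ker Gm` is the negative of its restriction to `ker Gp`. Hence `M` restricted
to `ker Gp` and its adjoint are both dissipative, so by the Lumer–Phillips theorem the former
generates a semigroup of contractions, the strong limit of the exponentials of the Yosida
approximations.

Along a smooth solution `d/dt ‖z‖² + ‖y‖² = ‖u‖² - (‖Gm z‖² - ‖P (Gm z)‖²)`, so the conditions on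
`P` are sufficient. They are necessary because every `g` is `Gm z` for some `z` with `M z = -z`,
which is the initial value of the smooth solution `exp (-t) z`.
-/

noncomputable section

section ContractionExponential

open NormedSpace (exp)

variable {E : Type*} [NormedAddCommGroup E] [NormedSpace ℂ E] {S S' : E →L[ℂ] E}

/-- The bounded operator `S` generates a semigroup of contractions. -/
def GeneratesContractions (S : E →L[ℂ] E) : Prop :=
  ∀ t : ℝ, 0 ≤ t → ‖exp (t • S)‖ ≤ 1

theorem norm_exp_smul_le_exp {J : E →L[ℂ] E} (hJ : ‖J‖ ≤ 1) {r : ℝ} (hr : 0 ≤ r) :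
    ‖exp (r • J)‖ ≤ Real.exp r := by
  have norm_pow_le (n : ℕ) : ‖J ^ n‖ ≤ 1 := by
    cases n with
    | zero => exact ContinuousLinearMap.norm_id_le
    | succ n => exact (norm_pow_le' J n.succ_pos).trans (pow_le_one₀ (norm_nonneg J) hJ)
  rw [NormedSpace.exp_eq_tsum ℝ, Real.exp_eq_exp_ℝ]
  refine tsum_of_norm_bounded (NormedSpace.exp_series_hasSum_exp' (𝕂 := ℝ) r) fun n => ?_
  rw [smul_pow, norm_smul, norm_smul, norm_pow, Real.norm_of_nonneg hr,
    Real.norm_of_nonneg (by positivity), smul_eq_mul]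
  exact mul_le_mul_of_nonneg_left (mul_le_of_le_one_right (by positivity) (norm_pow_le n))
    (by positivity)

theorem GeneratesContractions.norm_exp_apply_le (hS : GeneratesContractions S) {t : ℝ}
    (ht : 0 ≤ t) (x : E) : ‖exp (t • S) x‖ ≤ ‖x‖ := by
  simpa only [one_mul] using ContinuousLinearMap.le_of_opNorm_le _ (hS t ht) x

variable [CompleteSpace E]

theorem generatesContractions_smul_sub_one {J : E →L[ℂ] E} (hJ : ‖J‖ ≤ 1) {c : ℝ} (hc : 0 ≤ c) :
    GeneratesContractions (c • (J - 1)) := by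
  intro t ht
  let : NormedAlgebra ℚ (E →L[ℂ] E) := NormedAlgebra.restrictScalars ℚ ℝ _
  have split : t • c • (J - 1) = (t * c) • J + (-(t * c)) • (1 : E →L[ℂ] E) := by module
  have exp_scalar : exp ((-(t * c)) • (1 : E →L[ℂ] E)) = Real.exp (-(t * c)) • 1 := by
    rw [← Algebra.algebraMap_eq_smul_one, ← NormedSpace.algebraMap_exp_comm, Real.exp_eq_exp_ℝ,
      Algebra.algebraMap_eq_smul_one]
  have commute : Commute ((t * c) • J) ((-(t * c)) • (1 : E →L[ℂ] E)) :=
    ((Commute.one_right J).smul_left _).smul_right _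
  calc ‖exp (t • c • (J - 1))‖
      = Real.exp (-(t * c)) * ‖exp ((t * c) • J)‖ := by
        rw [split, NormedSpace.exp_add_of_commute commute, exp_scalar, mul_smul_comm, mul_one,
          norm_smul, Real.norm_of_nonneg (Real.exp_pos _).le]
    _ ≤ Real.exp (-(t * c)) * Real.exp (t * c) := by
        gcongr
        exact norm_exp_smul_le_exp hJ (mul_nonneg ht hc)
    _ = 1 := by rw [← Real.exp_add, neg_add_cancel, Real.exp_zero]

theorem hasDerivAt_exp_smul_apply (S : E →L[ℂ] E) (x : E) (t : ℝ) :
    HasDerivAt (fun s : ℝ => exp (s • S) x) (exp (t • S) (S x)) t :=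
  ((ContinuousLinearMap.apply ℂ E x).restrictScalars ℝ).hasFDerivAt.comp_hasDerivAt t
    (hasDerivAt_exp_smul_const (𝕂 := ℝ) S t)

theorem hasDerivAt_exp_smul_mul_exp_smul_apply (h : Commute S S') (x : E) (t s : ℝ) :
    HasDerivAt (fun r => exp (r • S) (exp ((t - r) • S') x))
      (exp (s • S) (exp ((t - s) • S') (S x - S' x))) s := by
  have deriv_left := hasDerivAt_exp_smul_const (𝕂 := ℝ) S s
  have deriv_right := (hasDerivAt_exp_smul_const (𝕂 := ℝ) S' (t - s)).scomp s
    ((hasDerivAt_id s).const_sub t)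
  have commute_apply : S (exp ((t - s) • S') x) = exp ((t - s) • S') (S x) :=
    DFunLike.congr_fun (h.smul_right (t - s)).exp_right.eq x
  refine (((ContinuousLinearMap.apply ℂ E x).restrictScalars ℝ).hasFDerivAt.comp_hasDerivAt s
    (deriv_left.mul deriv_right)).congr_deriv ?_
  change exp (s • S) (S (exp ((t - s) • S') x)) +
    exp (s • S) ((-1 : ℝ) • exp ((t - s) • S') (S' x)) = _
  rw [commute_apply, neg_one_smul, ← map_add, ← sub_eq_add_neg, ← map_sub]

theorem GeneratesContractions.norm_exp_apply_sub_le (hS : GeneratesContractions S)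
    (hS' : GeneratesContractions S') (h : Commute S S') {t : ℝ} (ht : 0 ≤ t) (x : E) :
    ‖exp (t • S) x - exp (t • S') x‖ ≤ t * ‖S x - S' x‖ := by
  have bound := (convex_Icc 0 t).norm_image_sub_le_of_norm_hasDerivWithin_le
    (fun s _ => (hasDerivAt_exp_smul_mul_exp_smul_apply h x t s).hasDerivWithinAt)
    (fun s hs => (hS.norm_exp_apply_le hs.1 _).trans
      (hS'.norm_exp_apply_le (sub_nonneg.2 hs.2) _))
    (left_mem_Icc.2 ht) (right_mem_Icc.2 ht)
  simpa [Real.norm_of_nonneg ht, mul_comm] using bound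

theorem GeneratesContractions.lipschitzOnWith_exp_apply (hS : GeneratesContractions S) (x : E) :
    LipschitzOnWith ‖S x‖₊ (fun t : ℝ => exp (t • S) x) (Ici 0) :=
  (convex_Ici 0).lipschitzOnWith_of_nnnorm_hasDerivWithin_le
    (fun t _ => (hasDerivAt_exp_smul_apply S x t).hasDerivWithinAt)
    fun _ ht => hS.norm_exp_apply_le ht _

theorem continuous_exp_smul_apply (S : E →L[ℂ] E) (x : E) :
    Continuous fun t : ℝ => exp (t • S) x :=
  continuous_iff_continuousAt.2 fun t => (hasDerivAt_exp_smul_apply S x t).continuousAt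

theorem integral_exp_smul_apply (S : E →L[ℂ] E) (x : E) (t : ℝ) :
    ∫ s in (0 : ℝ)..t, exp (s • S) (S x) = exp (t • S) x - x := by
  rw [intervalIntegral.integral_eq_sub_of_hasDerivAt
    (fun s _ => hasDerivAt_exp_smul_apply S x s)
    ((continuous_exp_smul_apply S (S x)).intervalIntegrable 0 t),
    zero_smul, NormedSpace.exp_zero, one_apply_eq_self]

end ContractionExponential

section StrongLimit

variable {E : Type*} [NormedAddCommGroup E] [NormedSpace ℂ E]

theorem tendsto_apply_of_tendsto {V : ℕ → E →L[ℂ] E} (hV : ∀ n, ‖V n‖ ≤ 1) {W : E →L[ℂ] E}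
    (hVW : ∀ x, Tendsto (fun n => V n x) atTop (𝓝 (W x))) {y : ℕ → E} {x : E}
    (hy : Tendsto y atTop (𝓝 x)) : Tendsto (fun n => V n (y n)) atTop (𝓝 (W x)) := by
  have diff : Tendsto (fun n => V n (y n - x)) atTop (𝓝 0) :=
    squeeze_zero_norm (fun n => (V n).le_of_opNorm_le (hV n) _)
      (by simpa using (tendsto_iff_norm_sub_tendsto_zero.1 hy))
  simpa using diff.add (hVW x)

theorem tendsto_apply_self_of_dense {D : Set E} (hD : Dense D) {V : ℕ → E →L[ℂ] E}
    (hV : ∀ n, ‖V n‖ ≤ 1) (h : ∀ x ∈ D, Tendsto (fun n => V n x) atTop (𝓝 x)) (x : E) :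
    Tendsto (fun n => V n x) atTop (𝓝 x) := by
  have equicontinuous : Equicontinuous fun n => ⇑(V n) :=
    (LipschitzWith.uniformEquicontinuous _ 1 fun n =>
      (V n).lipschitzWith_of_opNorm_le (hV n)).equicontinuous
  exact (equicontinuous.isClosed_setOfPred_tendsto continuous_id).closure_subset_iff.2 h (hD x)

theorem cauchySeq_apply_of_dense {D : Set E} (hD : Dense D) {V : ℕ → E →L[ℂ] E}
    (hV : ∀ n, ‖V n‖ ≤ 1) (h : ∀ x ∈ D, CauchySeq fun n => V n x) (x : E) :
    CauchySeq fun n => V n x := by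
  rw [Metric.cauchySeq_iff]
  intro ε hε
  obtain ⟨w, hxw, hw⟩ := Metric.dense_iff.1 hD x (ε / 3) (by positivity)
  obtain ⟨N, hN⟩ := Metric.cauchySeq_iff.1 (h w hw) (ε / 3) (by positivity)
  have close (n : ℕ) : dist (V n w) (V n x) < ε / 3 :=
    ((V n).dist_le_opNorm w x).trans_lt
      ((mul_le_of_le_one_left dist_nonneg (hV n)).trans_lt hxw)
  refine ⟨N, fun m hm n hn => ?_⟩
  linarith [dist_triangle4 (V m x) (V m w) (V n w) (V n x), close n, close m,
    dist_comm (V m w) (V m x), hN m hm n hn]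

theorem continuousOn_apply_of_dense {ι : Type*} [TopologicalSpace ι] {s : Set ι}
    {T : ι → E →L[ℂ] E} (hT : ∀ t ∈ s, ‖T t‖ ≤ 1) {D : Set E} (hD : Dense D)
    (h : ∀ x ∈ D, ContinuousOn (fun t => T t x) s) (x : E) : ContinuousOn (fun t => T t x) s := by
  refine continuousOn_of_uniform_approx_of_continuousOn fun u hu => ?_
  obtain ⟨ε, hε, hu⟩ := Metric.mem_uniformity_dist.1 hu
  obtain ⟨w, hxw, hw⟩ := Metric.dense_iff.1 hD x ε hε
  refine ⟨fun t => T t w, h w hw, fun t ht => hu ?_⟩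
  calc dist (T t x) (T t w) ≤ ‖T t‖ * dist x w := (T t).dist_le_opNorm x w
    _ ≤ dist x w := mul_le_of_le_one_left dist_nonneg (hT t ht)
    _ < ε := by rwa [dist_comm]

end StrongLimit

section ExpLimit

open NormedSpace (exp)

variable {E : Type*} [NormedAddCommGroup E] [NormedSpace ℂ E]
  {S : ℕ → E →L[ℂ] E} {T : ℝ → E →L[ℂ] E}

/-- The operators `T t`, `t ≥ 0`, are the strong limits of the exponentials `exp (t S n)`. -/
def IsExpLimit (S : ℕ → E →L[ℂ] E) (T : ℝ → E →L[ℂ] E) : Prop :=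
  ∀ t : ℝ, 0 ≤ t → ∀ x, Tendsto (fun n => exp (t • S n) x) atTop (𝓝 (T t x))

theorem exists_isExpLimit [CompleteSpace E] (hS : ∀ n, GeneratesContractions (S n))
    (hc : ∀ m n, Commute (S m) (S n)) {D : Set E} (hD : Dense D)
    (h : ∀ x ∈ D, CauchySeq fun n => S n x) : ∃ T, IsExpLimit S T := by
  have cauchySeq_exp (t : ℝ) (ht : 0 ≤ t) (x : E) (hx : x ∈ D) :
      CauchySeq fun n => exp (t • S n) x := by
    have dist_tendsto := (cauchySeq_iff_tendsto_dist_atTop_0.1 (h x hx)).const_mul t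
    rw [mul_zero] at dist_tendsto
    refine cauchySeq_iff_tendsto_dist_atTop_0.2
      (squeeze_zero (fun _ => dist_nonneg) (fun p => ?_) dist_tendsto)
    simpa only [dist_eq_norm] using (hS p.1).norm_exp_apply_sub_le (hS p.2) (hc p.1 p.2) ht x
  have exists_limit (t : ℝ) :
      ∃ V : E →L[ℂ] E, 0 ≤ t → ∀ x, Tendsto (fun n => exp (t • S n) x) atTop (𝓝 (V x)) := by
    rcases lt_or_ge t 0 with ht | ht
    · exact ⟨0, fun ht' => absurd ht ht'.not_gt⟩
    · choose V hV using fun x => cauchySeq_tendsto_of_complete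
        (cauchySeq_apply_of_dense hD (fun n => hS n t ht) (cauchySeq_exp t ht) x)
      exact ⟨continuousLinearMapOfTendsto _ (tendsto_pi_nhds.2 hV), fun _ => hV⟩
  choose T hT using exists_limit
  exact ⟨T, hT⟩

namespace IsExpLimit

theorem norm_le_one (hT : IsExpLimit S T) (hS : ∀ n, GeneratesContractions (S n)) {t : ℝ}
    (ht : 0 ≤ t) : ‖T t‖ ≤ 1 :=
  ContinuousLinearMap.opNorm_le_bound _ zero_le_one fun x => by
    simpa only [one_mul] using
      le_of_tendsto' (hT t ht x).norm fun n => (hS n).norm_exp_apply_le ht x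

theorem map_zero (hT : IsExpLimit S T) : T 0 = 1 := by
  ext x
  refine tendsto_nhds_unique (hT 0 le_rfl x) ?_
  simp only [zero_smul, NormedSpace.exp_zero, one_apply_eq_self, tendsto_const_nhds_iff]

theorem map_add [CompleteSpace E] (hT : IsExpLimit S T)
    (hS : ∀ n, GeneratesContractions (S n)) {s t : ℝ} (hs : 0 ≤ s) (ht : 0 ≤ t) :
    T (s + t) = (T s).comp (T t) := by
  have exp_add (n : ℕ) (x : E) : exp ((s + t) • S n) x = exp (s • S n) (exp (t • S n) x) := by
    let : NormedAlgebra ℚ (E →L[ℂ] E) := NormedAlgebra.restrictScalars ℚ ℝ _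
    rw [add_smul, NormedSpace.exp_add_of_commute
      (((Commute.refl (S n)).smul_left s).smul_right t)]
    rfl
  ext x
  refine tendsto_nhds_unique (hT _ (add_nonneg hs ht) x) ?_
  exact (tendsto_apply_of_tendsto (fun n => hS n s hs) (hT s hs) (hT t ht x)).congr
    fun n => (exp_add n x).symm

theorem lipschitzOnWith_apply [CompleteSpace E] (hT : IsExpLimit S T)
    (hS : ∀ n, GeneratesContractions (S n)) {x : E} {C : NNReal} (hC : ∀ n, ‖S n x‖ ≤ C) :
    LipschitzOnWith C (fun t => T t x) (Ici 0) :=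
  LipschitzOnWith.of_dist_le_mul fun s hs t ht =>
    le_of_tendsto' ((hT s hs x).dist (hT t ht x)) fun n =>
      (((hS n).lipschitzOnWith_exp_apply x).weaken (hC n)).dist_le_mul s hs t ht

theorem integral_apply [CompleteSpace E] (hT : IsExpLimit S T)
    (hS : ∀ n, GeneratesContractions (S n)) {x y : E} (hx : Tendsto (fun n => S n x) atTop (𝓝 y))
    {C : ℝ} (hC : ∀ n, ‖S n x‖ ≤ C) {t : ℝ} (ht : 0 ≤ t) :
    ∫ s in (0 : ℝ)..t, T s y = T t x - x := by
  have nonneg {s : ℝ} (hs : s ∈ uIoc 0 t) : 0 ≤ s := by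
    rw [uIoc_of_le ht] at hs
    exact hs.1.le
  have integral_tendsto :
      Tendsto (fun n => ∫ s in (0 : ℝ)..t, exp (s • S n) (S n x)) atTop
        (𝓝 (∫ s in (0 : ℝ)..t, T s y)) :=
    intervalIntegral.tendsto_integral_filter_of_dominated_convergence (fun _ => C)
      (.of_forall fun n => (continuous_exp_smul_apply (S n) (S n x)).aestronglyMeasurable)
      (.of_forall fun n => .of_forall fun s hs =>
        ((hS n).norm_exp_apply_le (nonneg hs) _).trans (hC n))
      intervalIntegrable_const
      (.of_forall fun s hs => tendsto_apply_of_tendsto (fun n => hS n s (nonneg hs))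
        (hT s (nonneg hs)) hx)
  simp only [integral_exp_smul_apply] at integral_tendsto
  exact tendsto_nhds_unique integral_tendsto ((hT t ht x).sub_const x)

theorem tendsto_slope [CompleteSpace E] (hT : IsExpLimit S T)
    (hS : ∀ n, GeneratesContractions (S n)) {x y : E} (hx : Tendsto (fun n => S n x) atTop (𝓝 y))
    {C : ℝ} (hC : ∀ n, ‖S n x‖ ≤ C) (hy : ContinuousOn (fun t => T t y) (Ici 0)) :
    Tendsto (fun t : ℝ => t⁻¹ • (T t x - x)) (𝓝[>] 0) (𝓝 y) := by
  have deriv_integral :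
      HasDerivWithinAt (fun t => ∫ s in (0 : ℝ)..t, T s y) (T 0 y) (Ici 0) 0 :=
    intervalIntegral.integral_hasDerivWithinAt_right (t := Ioi 0) IntervalIntegrable.refl
      ((hy.mono Ioi_subset_Ici_self).stronglyMeasurableAtFilter_nhdsWithin measurableSet_Ioi 0)
      ((hy 0 self_mem_Ici).mono Ioi_subset_Ici_self)
  rw [hT.map_zero] at deriv_integral
  refine ((hasDerivWithinAt_iff_tendsto_slope' self_notMem_Ioi).1
    (deriv_integral.mono Ioi_subset_Ici_self)).congr' ?_
  filter_upwards [self_mem_nhdsWithin] with t ht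
  rw [slope_def_module, sub_zero, intervalIntegral.integral_same, sub_zero,
    hT.integral_apply hS hx hC (le_of_lt ht)]

end IsExpLimit

end ExpLimit

section Resolvent

variable {E : Type*} [NormedAddCommGroup E] [NormedSpace ℂ E] {A : E →ₗ.[ℂ] E}
  {μ μ' : ℂ} {R R' : E →L[ℂ] E}

/-- `R` is the bounded inverse `(μ - A)⁻¹`, that is, the resolvent of `A` at `μ`. -/
structure IsResolventAt (A : E →ₗ.[ℂ] E) (μ : ℂ) (R : E →L[ℂ] E) : Prop where
  right_inv : ∀ x, ∃ h : R x ∈ A.domain, μ • R x - A ⟨R x, h⟩ = x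
  left_inv : ∀ x : A.domain, R (μ • (x : E) - A x) = x

namespace IsResolventAt

theorem apply_sub_apply (h : IsResolventAt A μ R) (h' : IsResolventAt A μ' R') (x : E) :
    R x - R' x = (μ' - μ) • R (R' x) := by
  obtain ⟨mem, hx⟩ := h'.right_inv x
  have shift : μ • R' x - A ⟨R' x, mem⟩ = x - (μ' - μ) • R' x := by
    linear_combination (norm := module) hx
  have h_left := h.left_inv ⟨R' x, mem⟩
  rw [shift, map_sub, map_smul] at h_left
  exact (sub_eq_iff_eq_add.2 (sub_eq_iff_eq_add'.1 h_left))

theorem commute (h : IsResolventAt A μ R) (h' : IsResolventAt A μ' R') : Commute R R' := by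
  ext x
  change R (R' x) = R' (R x)
  rcases eq_or_ne μ' μ with rfl | hne
  · have eq (x : E) : R x = R' x := by
      rw [← sub_eq_zero, h.apply_sub_apply h', sub_self, zero_smul]
    rw [eq, eq x]
  · refine smul_right_injective E (sub_ne_zero.2 hne) ?_
    change (μ' - μ) • R (R' x) = (μ' - μ) • R' (R x)
    rw [← h.apply_sub_apply h', ← neg_sub μ, neg_smul, ← h'.apply_sub_apply h, neg_sub]

theorem apply_apply (h : IsResolventAt A μ R) (x : A.domain) : R (A x) = μ • R x - x := by
  have h_left := h.left_inv x
  rw [map_sub, map_smul] at h_left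
  exact eq_sub_iff_add_eq'.2 (sub_eq_iff_eq_add.1 h_left).symm

end IsResolventAt

/-- The Yosida approximation `l (l R - 1) = l A (l - A)⁻¹` of an operator `A` with resolvent `R`
at `l`. -/
def yosidaApprox (l : ℝ) (R : E →L[ℂ] E) : E →L[ℂ] E :=
  l • (l • R - 1)

theorem IsResolventAt.yosidaApprox_apply {l : ℝ} (h : IsResolventAt A l R) (x : A.domain) :
    yosidaApprox l R x = (l • R) (A x) := by
  change l • (l • R x - (x : E)) = l • R (A x)
  rw [h.apply_apply, Complex.coe_smul]

theorem commute_yosidaApprox (h : Commute R R') (l l' : ℝ) :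
    Commute (yosidaApprox l R) (yosidaApprox l' R') :=
  ((((h.smul_left l).smul_right l').sub_left (Commute.one_left _)).sub_right
    (Commute.one_right _)).smul_left l |>.smul_right l'

end Resolvent

section Yosida

variable {E : Type*} [NormedAddCommGroup E] [NormedSpace ℂ E] {A : E →ₗ.[ℂ] E}
  {l : ℕ → ℝ} {R : ℕ → E →L[ℂ] E}

theorem norm_smul_le_one_of_norm_le_inv {c : ℝ} (hc : 0 < c) {V : E →L[ℂ] E} (hV : ‖V‖ ≤ c⁻¹) :
    ‖c • V‖ ≤ 1 := by
  rw [norm_smul, Real.norm_of_nonneg hc.le]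
  exact (mul_le_mul_of_nonneg_left hV hc.le).trans_eq (mul_inv_cancel₀ hc.ne')

theorem tendsto_smul_resolvent (hl : ∀ n, 0 < l n) (hl_top : Tendsto l atTop atTop)
    (hR : ∀ n, IsResolventAt A (l n) (R n)) (hR_le : ∀ n, ‖R n‖ ≤ (l n)⁻¹)
    (hA : Dense (A.domain : Set E)) (x : E) :
    Tendsto (fun n => (l n • R n) x) atTop (𝓝 x) := by
  refine tendsto_apply_self_of_dense hA
    (fun n => norm_smul_le_one_of_norm_le_inv (hl n) (hR_le n)) (fun x hx => ?_) x
  have bound_tendsto : Tendsto (fun n => (l n)⁻¹ * ‖A ⟨x, hx⟩‖) atTop (𝓝 0) := by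
    simpa only [zero_mul, Function.comp_def] using
      (tendsto_inv_atTop_zero.comp hl_top).mul_const ‖A ⟨x, hx⟩‖
  refine tendsto_iff_norm_sub_tendsto_zero.2
    (squeeze_zero (fun _ => norm_nonneg _) (fun n => ?_) bound_tendsto)
  have sub_eq : (l n • R n) x - x = R n (A ⟨x, hx⟩) :=
    ((hR n).apply_apply ⟨x, hx⟩).symm
  rw [sub_eq]
  exact (R n).le_of_opNorm_le (hR_le n) _

theorem tendsto_yosidaApprox (hl : ∀ n, 0 < l n) (hl_top : Tendsto l atTop atTop)
    (hR : ∀ n, IsResolventAt A (l n) (R n)) (hR_le : ∀ n, ‖R n‖ ≤ (l n)⁻¹)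
    (hA : Dense (A.domain : Set E)) (x : A.domain) :
    Tendsto (fun n => yosidaApprox (l n) (R n) x) atTop (𝓝 (A x)) := by
  simpa only [(hR _).yosidaApprox_apply] using
    tendsto_smul_resolvent hl hl_top hR hR_le hA (A x)

theorem IsResolventAt.norm_yosidaApprox_apply_le {c : ℝ} (hc : 0 < c) {V : E →L[ℂ] E}
    (hV : IsResolventAt A c V) (hV_le : ‖V‖ ≤ c⁻¹) (x : A.domain) :
    ‖yosidaApprox c V x‖ ≤ ‖A x‖ := by
  rw [hV.yosidaApprox_apply, ← one_mul ‖A x‖]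
  exact ContinuousLinearMap.le_of_opNorm_le _ (norm_smul_le_one_of_norm_le_inv hc hV_le) _

end Yosida

section Dissipative

variable {X : Type*} [NormedAddCommGroup X] [InnerProductSpace ℂ X] {A : X →ₗ.[ℂ] X}

/-- Dissipative operators in a Hilbert space. -/
def IsDissipative (A : X →ₗ.[ℂ] X) : Prop :=
  ∀ x : A.domain, (inner ℂ (x : X) (A x)).re ≤ 0

theorem re_inner_self_ofReal_smul (l : ℝ) (x : X) : (inner ℂ x ((l : ℂ) • x)).re = l * ‖x‖ ^ 2 := by
  rw [inner_smul_right, inner_self_eq_norm_sq_to_K, Complex.re_ofReal_mul]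
  norm_cast

namespace IsDissipative

theorem norm_le (hA : IsDissipative A) {l : ℝ} (hl : 0 < l) (x : A.domain) :
    ‖(x : X)‖ ≤ l⁻¹ * ‖(l : ℂ) • (x : X) - A x‖ := by
  rcases (norm_nonneg (x : X)).eq_or_lt with hx | hx
  · rw [← hx]
    positivity
  have re_inner_eq : (inner ℂ (x : X) ((l : ℂ) • (x : X) - A x)).re =
      l * ‖(x : X)‖ ^ 2 - (inner ℂ (x : X) (A x)).re := by
    rw [inner_sub_right, Complex.sub_re, re_inner_self_ofReal_smul]
  have cauchy_schwarz := re_inner_eq.symm.trans_le (re_inner_le_norm (𝕜 := ℂ) _ _)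
  rw [inv_mul_eq_div, le_div_iff₀ hl]
  refine le_of_mul_le_mul_left ?_ hx
  linarith [hA x]

theorem eq_zero_of_apply_eq_smul (hA : IsDissipative A) {l : ℝ} (hl : 0 < l) {x : A.domain}
    (hx : A x = (l : ℂ) • (x : X)) : (x : X) = 0 := by
  have h := hA.norm_le hl x
  rwa [hx, sub_self, norm_zero, mul_zero, norm_le_zero_iff] at h

theorem exists_isResolventAt (hA : IsDissipative A) {l : ℝ} (hl : 0 < l)
    (hr : ∀ y, ∃ x : A.domain, (l : ℂ) • (x : X) - A x = y) :
    ∃ R : X →L[ℂ] X, IsResolventAt A l R ∧ ‖R‖ ≤ l⁻¹ := by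
  let V : A.domain →ₗ[ℂ] X := (l : ℂ) • A.domain.subtype - A.toFun
  have injective : Function.Injective V := by
    rw [injective_iff_map_eq_zero]
    intro x hx
    exact Subtype.ext (hA.eq_zero_of_apply_eq_smul hl (sub_eq_zero.1 hx).symm)
  let e : A.domain ≃ₗ[ℂ] X := LinearEquiv.ofBijective V ⟨injective, hr⟩
  have apply_symm (y : X) : (l : ℂ) • (e.symm y : X) - A (e.symm y) = y := e.apply_symm_apply y
  let R : X →L[ℂ] X := (A.domain.subtype ∘ₗ e.symm.toLinearMap).mkContinuous l⁻¹ fun y =>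
    (hA.norm_le hl (e.symm y)).trans_eq (by rw [apply_symm])
  exact ⟨R, ⟨fun x => ⟨(e.symm x).2, apply_symm x⟩,
    fun x => congrArg Subtype.val (e.symm_apply_apply x)⟩,
    LinearMap.mkContinuous_norm_le _ (inv_nonneg.2 hl.le) _⟩

theorem dense_domain [CompleteSpace X] (hA : IsDissipative A) {l : ℝ} (hl : 0 < l)
    (hr : ∀ y, ∃ x : A.domain, (l : ℂ) • (x : X) - A x = y) : Dense (A.domain : Set X) := by
  rw [Submodule.dense_iff_topologicalClosure_eq_top, Submodule.topologicalClosure_eq_top_iff,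
    Submodule.eq_bot_iff]
  intro v hv
  obtain ⟨w, rfl⟩ := hr v
  have orthogonal := congrArg Complex.re (hv w w.2)
  rw [inner_sub_right, Complex.sub_re, re_inner_self_ofReal_smul, Complex.zero_re] at orthogonal
  have norm_sq_le : ‖(w : X)‖ ^ 2 ≤ 0 :=
    nonpos_of_mul_nonpos_right ((sub_eq_zero.1 orthogonal).trans_le (hA w)) hl
  have w_eq_zero : w = 0 :=
    Subtype.ext (norm_eq_zero.1 (pow_eq_zero_iff two_ne_zero |>.1
      (le_antisymm norm_sq_le (sq_nonneg _))))
  rw [w_eq_zero, LinearPMap.map_zero, ZeroMemClass.coe_zero, smul_zero, sub_zero]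

end IsDissipative

theorem re_inner_nonpos_of_tendsto_slope {T : ℝ → X →L[ℂ] X} (hT : ∀ t, 0 ≤ t → ‖T t‖ ≤ 1)
    {x y : X} (h : Tendsto (fun t : ℝ => t⁻¹ • (T t x - x)) (𝓝[>] 0) (𝓝 y)) :
    (inner ℂ x y).re ≤ 0 := by
  refine le_of_tendsto
    ((Complex.continuous_re.tendsto _).comp ((tendsto_const_nhds (x := x)).inner (𝕜 := ℂ) h))
    (eventually_nhdsWithin_of_forall fun t ht => ?_)
  have re_inner_le : (inner ℂ x (T t x)).re ≤ ‖x‖ ^ 2 :=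
    calc (inner ℂ x (T t x)).re ≤ ‖x‖ * ‖T t x‖ := re_inner_le_norm (𝕜 := ℂ) x (T t x)
      _ ≤ ‖x‖ * (1 * ‖x‖) := by
        gcongr
        exact (T t).le_of_opNorm_le (hT t (le_of_lt ht)) x
      _ = ‖x‖ ^ 2 := by ring
  have re_inner_self : (inner ℂ x x).re = ‖x‖ ^ 2 := inner_self_eq_norm_sq (𝕜 := ℂ) x
  change (inner ℂ x (t⁻¹ • (T t x - x))).re ≤ 0
  rw [← Complex.coe_smul, inner_smul_right, Complex.re_ofReal_mul, inner_sub_right,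
    Complex.sub_re, re_inner_self]
  exact mul_nonpos_of_nonneg_of_nonpos (inv_nonneg.2 (le_of_lt ht)) (sub_nonpos.2 re_inner_le)

/-- The right derivative at `0` of a semigroup of contractions is dissipative; a dissipative
extension of `A` is `A` itself as soon as `1 - A` is onto. -/
theorem mem_graph_of_tendsto_slope {T : ℝ → X →L[ℂ] X} (hT : ∀ t, 0 ≤ t → ‖T t‖ ≤ 1)
    (hTA : ∀ x : A.domain, Tendsto (fun t : ℝ => t⁻¹ • (T t x - x)) (𝓝[>] 0) (𝓝 (A x)))
    (hr : ∀ y, ∃ x : A.domain, (x : X) - A x = y) {x y : X}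
    (h : Tendsto (fun t : ℝ => t⁻¹ • (T t x - x)) (𝓝[>] 0) (𝓝 y)) : (x, y) ∈ A.graph := by
  obtain ⟨w, hw⟩ := hr (x - y)
  have diff_eq : y - A w = x - w := by
    rw [sub_eq_sub_iff_add_eq_add, ← sub_eq_sub_iff_add_eq_add.1 hw, add_comm]
  have diff_slope : Tendsto (fun t : ℝ => t⁻¹ • (T t (x - w) - (x - w))) (𝓝[>] 0) (𝓝 (x - w)) := by
    have sub_tendsto := h.sub (hTA w)
    rw [diff_eq] at sub_tendsto
    refine sub_tendsto.congr fun t => ?_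
    rw [← smul_sub, map_sub, sub_sub_sub_comm]
  have norm_sq_le : ‖x - w‖ ^ 2 ≤ 0 :=
    (inner_self_eq_norm_sq (𝕜 := ℂ) (x - w)).symm.trans_le
      (re_inner_nonpos_of_tendsto_slope hT diff_slope)
  have x_eq : x - w = 0 :=
    norm_eq_zero.1 (pow_eq_zero_iff two_ne_zero |>.1 (le_antisymm norm_sq_le (sq_nonneg _)))
  rw [x_eq] at diff_eq
  rw [sub_eq_zero.1 x_eq, sub_eq_zero.1 diff_eq]
  exact A.mem_graph w

/-- The Lumer–Phillips theorem in a Hilbert space. -/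
theorem IsDissipative.generatesC0Semigroup [CompleteSpace X] (hA : IsDissipative A)
    (hr : ∀ l : ℝ, 0 < l → ∀ y, ∃ x : A.domain, (l : ℂ) • (x : X) - A x = y) :
    A.GeneratesC0Semigroup := by
  have hd := hA.dense_domain one_pos (hr 1 one_pos)
  let l : ℕ → ℝ := fun n => n + 1
  have l_pos (n : ℕ) : 0 < l n := n.cast_add_one_pos
  have l_tendsto : Tendsto l atTop atTop :=
    tendsto_atTop_add_const_right _ 1 tendsto_natCast_atTop_atTop
  choose R hR hR_le using fun n => hA.exists_isResolventAt (l_pos n) (hr (l n) (l_pos n))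
  let S : ℕ → X →L[ℂ] X := fun n => yosidaApprox (l n) (R n)
  have contractions (n : ℕ) : GeneratesContractions (S n) :=
    generatesContractions_smul_sub_one (norm_smul_le_one_of_norm_le_inv (l_pos n) (hR_le n))
      (l_pos n).le
  have S_tendsto (x : A.domain) : Tendsto (fun n => S n x) atTop (𝓝 (A x)) :=
    tendsto_yosidaApprox l_pos l_tendsto hR hR_le hd x
  have S_le (x : A.domain) (n : ℕ) : ‖S n x‖ ≤ ‖A x‖ :=
    (hR n).norm_yosidaApprox_apply_le (l_pos n) (hR_le n) x
  obtain ⟨T, hT⟩ := exists_isExpLimit contractions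
    (fun m n => commute_yosidaApprox ((hR m).commute (hR n)) (l m) (l n)) hd
    fun x hx => (S_tendsto ⟨x, hx⟩).cauchySeq
  have T_le (t : ℝ) (ht : 0 ≤ t) : ‖T t‖ ≤ 1 := hT.norm_le_one contractions ht
  have T_continuousOn : ∀ x, ContinuousOn (fun t => T t x) (Ici 0) :=
    continuousOn_apply_of_dense T_le hd fun x hx =>
      (hT.lipschitzOnWith_apply (C := ‖A ⟨x, hx⟩‖₊) contractions (S_le ⟨x, hx⟩)).continuousOn
  have T_slope (x : A.domain) : Tendsto (fun t : ℝ => t⁻¹ • (T t x - x)) (𝓝[>] 0) (𝓝 (A x)) :=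
    hT.tendsto_slope contractions (S_tendsto x) (S_le x) (T_continuousOn _)
  refine ⟨T, ⟨hT.map_zero, fun s t hs ht => hT.map_add contractions hs ht, T_continuousOn⟩,
    fun x y => ⟨fun h => ?_, mem_graph_of_tendsto_slope T_le T_slope ?_⟩⟩
  · obtain ⟨x, rfl, rfl⟩ := (LinearPMap.mem_graph_iff A).1 h
    exact T_slope x
  · simpa only [Complex.ofReal_one, one_smul] using hr 1 one_pos

end Dissipative

section Adjoint

variable {𝕜 E F : Type*} [RCLike 𝕜] [NormedAddCommGroup E] [InnerProductSpace 𝕜 E]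
  [NormedAddCommGroup F] [InnerProductSpace 𝕜 F]

theorem mem_graph_neg {A : E →ₗ.[𝕜] F} {x : E} {y : F} :
    (x, y) ∈ (-A).graph ↔ (x, -y) ∈ A.graph := by
  simp only [LinearPMap.mem_graph_iff, LinearPMap.neg_apply, neg_eq_iff_eq_neg]
  rfl

variable [CompleteSpace E]

theorem dense_domain_of_graph_adjoint {A : E →ₗ.[𝕜] F}
    (h : ∀ v, (0, v) ∈ A.graph.adjoint → v = 0) : Dense (A.domain : Set E) := by
  rw [Submodule.dense_iff_topologicalClosure_eq_top, Submodule.topologicalClosure_eq_top_iff,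
    Submodule.eq_bot_iff]
  intro v hv
  refine h v ((Submodule.mem_adjoint_iff _ _).2 fun a b hab => ?_)
  rw [inner_zero_right, hv a (LinearPMap.mem_domain_of_mem_graph hab), sub_zero]

variable [CompleteSpace F]

theorem adjoint_adjoint_of_isClosed {g : Submodule 𝕜 (E × F)} (hg : IsClosed (g : Set (E × F))) :
    g.adjoint.adjoint = g := by
  refine le_antisymm (fun x hx => ?_) fun x hx => ?_
  · let e : WithLp 2 (E × F) ≃L[𝕜] E × F := WithLp.prodContinuousLinearEquiv 2 𝕜 E F
    let Γ : Submodule 𝕜 (WithLp 2 (E × F)) := g.comap e.toLinearEquiv.toLinearMap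
    have Γ_isClosed : IsClosed (Γ : Set (WithLp 2 (E × F))) := hg.preimage e.continuous
    suffices WithLp.toLp 2 x ∈ Γᗮᗮ by
      rwa [Submodule.orthogonal_orthogonal_eq_closure,
        Γ_isClosed.submodule_topologicalClosure_eq] at this
    rw [Submodule.mem_orthogonal]
    intro u hu
    have mem_adjoint : (u.snd, -u.fst) ∈ g.adjoint := by
      rw [Submodule.mem_adjoint_iff]
      intro a b hab
      have orthogonal := (Submodule.mem_orthogonal _ _).1 hu (WithLp.toLp 2 (a, b)) hab
      rw [WithLp.prod_inner_apply] at orthogonal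
      rw [inner_neg_right, sub_neg_eq_add, add_comm]
      exact orthogonal
    have h := (Submodule.mem_adjoint_iff _ _).1 hx _ _ mem_adjoint
    rw [inner_neg_left] at h
    rw [WithLp.prod_inner_apply]
    change inner 𝕜 u.fst x.1 + inner 𝕜 u.snd x.2 = 0
    linear_combination -h
  · rw [Submodule.mem_adjoint_iff]
    intro a b hab
    have h := (Submodule.mem_adjoint_iff _ _).1 hab x.1 x.2 hx
    rw [← inner_conj_symm, ← inner_conj_symm a, ← map_sub, ← neg_sub, h, neg_zero, map_zero]

theorem adjoint_adjoint_of_isClosed_of_dense {A : E →ₗ.[𝕜] F} (hA : A.IsClosed)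
    (hd : Dense (A.domain : Set E)) : A.adjoint.adjoint = A := by
  have graph_adjoint_adjoint : A.adjoint.graph.adjoint = A.graph := by
    rw [LinearPMap.adjoint_graph_eq_graph_adjoint hd, adjoint_adjoint_of_isClosed hA]
  have dense_adjoint : Dense (A.adjoint.domain : Set F) :=
    dense_domain_of_graph_adjoint fun v hv =>
      A.graph_fst_eq_zero_snd (graph_adjoint_adjoint ▸ hv) rfl
  exact LinearPMap.eq_of_eq_graph
    ((LinearPMap.adjoint_graph_eq_graph_adjoint dense_adjoint).trans graph_adjoint_adjoint)

end Adjoint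

section MaximalDissipative

variable {X : Type*} [NormedAddCommGroup X] [InnerProductSpace ℂ X] [CompleteSpace X]
  {A : X →ₗ.[ℂ] X}

theorem IsDissipative.isClosed_range (hA : IsDissipative A) (hc : A.IsClosed) {l : ℝ}
    (hl : 0 < l) :
    IsClosed (LinearMap.range ((l : ℂ) • A.domain.subtype - A.toFun) : Set X) := by
  have : CompleteSpace A.graph := IsClosed.completeSpace_coe (hs := hc)
  let V : A.graph →L[ℂ] X :=
    (l : ℂ) • (ContinuousLinearMap.fst ℂ X X).comp A.graph.subtypeL -
      (ContinuousLinearMap.snd ℂ X X).comp A.graph.subtypeL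
  have range_eq : range V = LinearMap.range ((l : ℂ) • A.domain.subtype - A.toFun) := by
    ext y
    constructor
    · rintro ⟨⟨p, hp⟩, rfl⟩
      obtain ⟨x, hx, hx'⟩ := (LinearPMap.mem_graph_iff A).1 hp
      exact ⟨x, congrArg₂ (fun a b => (l : ℂ) • a - b) hx hx'⟩
    · rintro ⟨x, rfl⟩
      exact ⟨⟨_, A.mem_graph x⟩, rfl⟩
  rw [← range_eq]
  refine (V.antilipschitz_of_bound (K := (max l⁻¹ 2).toNNReal) ?_).isClosed_range
    V.uniformContinuous
  rintro ⟨p, hp⟩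
  obtain ⟨x, hx, hx'⟩ := (LinearPMap.mem_graph_iff A).1 hp
  obtain rfl : p = (↑x, A x) := Prod.ext hx.symm hx'.symm
  have norm_le := hA.norm_le hl x
  have norm_apply_le : ‖A x‖ ≤ 2 * ‖(l : ℂ) • (x : X) - A x‖ := by
    have norm_smul_le : ‖(l : ℂ) • (x : X)‖ ≤ ‖(l : ℂ) • (x : X) - A x‖ := by
      rw [norm_smul, Complex.norm_of_nonneg hl.le]
      rwa [inv_mul_eq_div, le_div_iff₀' hl] at norm_le
    linarith [norm_sub_le ((l : ℂ) • (x : X)) ((l : ℂ) • (x : X) - A x),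
      congrArg norm (sub_sub_cancel ((l : ℂ) • (x : X)) (A x))]
  rw [Real.coe_toNNReal _ (le_max_of_le_right zero_le_two)]
  exact max_le
    (norm_le.trans (mul_le_mul_of_nonneg_right (le_max_left _ _) (norm_nonneg _)))
    (norm_apply_le.trans (mul_le_mul_of_nonneg_right (le_max_right _ _) (norm_nonneg _)))

theorem IsDissipative.exists_smul_sub_eq (hA : IsDissipative A) (hc : A.IsClosed) {l : ℝ}
    (hl : 0 < l)
    (h : ∀ v, (∀ x : A.domain, inner ℂ ((l : ℂ) • (x : X) - A x) v = 0) → v = 0) (y : X) :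
    ∃ x : A.domain, (l : ℂ) • (x : X) - A x = y := by
  suffices LinearMap.range ((l : ℂ) • A.domain.subtype - A.toFun) = ⊤ from
    LinearMap.mem_range.1 (this ▸ Submodule.mem_top)
  rw [← (hA.isClosed_range hc hl).submodule_topologicalClosure_eq,
    Submodule.topologicalClosure_eq_top_iff, Submodule.eq_bot_iff]
  exact fun v hv => h v fun x => hv _ ⟨x, rfl⟩

end MaximalDissipative

section ScatteringTriple

variable {Z W : Type*} [NormedAddCommGroup Z] [InnerProductSpace ℂ Z]
  [NormedAddCommGroup W] [InnerProductSpace ℂ W]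
  {M : Z →ₗ.[ℂ] Z} {Gp Gm : M.domain →ₗ[ℂ] W}

/-- The restriction of an operator to the kernel of a boundary map. -/
def restrictKer (M : Z →ₗ.[ℂ] Z) (G : M.domain →ₗ[ℂ] W) : Z →ₗ.[ℂ] Z :=
  M.domRestrict ((LinearMap.ker G).map M.domain.subtype)

theorem mem_graph_restrictKer {v v' : Z} :
    (v, v') ∈ (restrictKer M Gp).graph ↔ ∃ z : M.domain, Gp z = 0 ∧ (z : Z) = v ∧ M z = v' := by
  rw [LinearPMap.mem_graph_iff]
  constructor
  · rintro ⟨⟨x, ⟨z, hz, rfl⟩, hx⟩, rfl, rfl⟩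
    exact ⟨z, hz, rfl, (LinearPMap.domRestrict_apply rfl).symm⟩
  · rintro ⟨z, hz, rfl, rfl⟩
    exact ⟨⟨z, ⟨z, hz, rfl⟩, z.2⟩, rfl, LinearPMap.domRestrict_apply rfl⟩

/-- A maximal operator `M` with two boundary maps, the incoming wave `Gp` and the outgoing wave
`Gm`. This is an ordinary boundary triplet of the skew-symmetric operator `-M*`, written in
scattering variables. -/
structure IsScatteringTriple (M : Z →ₗ.[ℂ] Z) (Gp Gm : M.domain →ₗ[ℂ] W) : Prop where
  closed : M.IsClosed
  adjoint_le : M.graph.adjoint ≤ (-M).graph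
  surjective : ∀ a b : W, ∃ z, Gp z = a ∧ Gm z = b
  green : ∀ z w : M.domain, inner ℂ (M z) (w : Z) + inner ℂ (z : Z) (M w) =
    inner ℂ (Gp z) (Gp w) - inner ℂ (Gm z) (Gm w)

theorem IsScatteringTriple.neg (h : IsScatteringTriple M Gp Gm) :
    IsScatteringTriple (-M) Gm Gp where
  closed := by
    have graph_eq : ((-M).graph : Set (Z × Z)) = (fun p => (p.1, -p.2)) ⁻¹' M.graph :=
      Set.ext fun _ => mem_graph_neg
    rw [LinearPMap.IsClosed, graph_eq]
    exact IsClosed.preimage (by fun_prop) h.closed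
  adjoint_le := by
    rintro ⟨w, w'⟩ hw
    have mem_adjoint : (w, -w') ∈ M.graph.adjoint := by
      rw [Submodule.mem_adjoint_iff] at hw ⊢
      intro a b hab
      have orthogonal := hw a (-b) (mem_graph_neg.2 ((neg_neg b).symm ▸ hab))
      rw [inner_neg_left] at orthogonal
      rw [inner_neg_right]
      linear_combination -orthogonal
    rw [neg_neg, ← neg_neg w']
    exact mem_graph_neg.1 (h.adjoint_le mem_adjoint)
  surjective a b := (h.surjective b a).imp fun _ => And.symm
  green z w := by
    rw [LinearPMap.neg_apply, LinearPMap.neg_apply, inner_neg_left, inner_neg_right]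
    linear_combination -h.green z w

namespace IsScatteringTriple

theorem dense_domain [CompleteSpace Z] (h : IsScatteringTriple M Gp Gm) :
    Dense (M.domain : Set Z) :=
  dense_domain_of_graph_adjoint fun _ hv =>
    LinearPMap.graph_fst_eq_zero_snd _ (h.adjoint_le hv) rfl

theorem exists_of_mem_adjoint (h : IsScatteringTriple M Gp Gm) {v v' : Z}
    (hv : (v, v') ∈ M.graph.adjoint) :
    ∃ z : M.domain, Gp z = 0 ∧ Gm z = 0 ∧ (z : Z) = v ∧ -M z = v' := by
  obtain ⟨z, rfl, rfl⟩ := (LinearPMap.mem_graph_iff _).1 (h.adjoint_le hv)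
  have boundary_form (w : M.domain) :
      inner ℂ (Gp w) (Gp z) - inner ℂ (Gm w) (Gm z) = 0 := by
    have hw := (Submodule.mem_adjoint_iff _ _).1 hv _ _ (M.mem_graph w)
    rw [← h.green, ← hw]
    change _ = inner ℂ (M w) (z : Z) - inner ℂ (w : Z) (-M z)
    rw [inner_neg_right, sub_neg_eq_add]
  refine ⟨z, ?_, ?_, rfl, rfl⟩
  · obtain ⟨w, hw, hw'⟩ := h.surjective (Gp z) 0
    simpa only [hw, hw', inner_zero_left, sub_zero, inner_self_eq_zero] using boundary_form w
  · obtain ⟨w, hw, hw'⟩ := h.surjective 0 (Gm z)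
    simpa only [hw, hw', inner_zero_left, zero_sub, neg_eq_zero, inner_self_eq_zero] using
      boundary_form w

/-- The adjoint of `M` restricted to `ker Gm` is `-M` restricted to `ker Gp`. -/
theorem mem_graph_restrictKer_iff [CompleteSpace Z] (h : IsScatteringTriple M Gp Gm) {v v' : Z} :
    (v, v') ∈ (restrictKer M Gp).graph ↔
      ∀ w : M.domain, Gm w = 0 → inner ℂ (M w) v + inner ℂ (w : Z) v' = 0 := by
  rw [mem_graph_restrictKer]
  constructor
  · rintro ⟨z, hz, rfl, rfl⟩ w hw
    rw [h.green, hz, hw, inner_zero_right, inner_zero_left, sub_zero]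
  · intro hv
    have mem_graph : (v, v') ∈ M.graph := by
      rw [← adjoint_adjoint_of_isClosed h.closed, Submodule.mem_adjoint_iff]
      intro a b hab
      obtain ⟨z, -, hz, rfl, rfl⟩ := h.exists_of_mem_adjoint hab
      rw [inner_neg_left]
      linear_combination -hv z hz
    obtain ⟨z, rfl, rfl⟩ := (LinearPMap.mem_graph_iff M).1 mem_graph
    obtain ⟨w, hw, hw'⟩ := h.surjective (Gp z) 0
    have boundary_form := hv w hw'
    change inner ℂ (M w) (z : Z) + inner ℂ (w : Z) (M z) = 0 at boundary_form
    rw [h.green, hw, hw', inner_zero_left, sub_zero, inner_self_eq_zero] at boundary_form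
    exact ⟨z, boundary_form, rfl, rfl⟩

theorem isClosed_restrictKer [CompleteSpace Z] (h : IsScatteringTriple M Gp Gm) :
    (restrictKer M Gp).IsClosed := by
  have graph_eq : ((restrictKer M Gp).graph : Set (Z × Z)) = ⋂ (w : M.domain) (_ : Gm w = 0),
      {p : Z × Z | inner ℂ (M w) p.1 + inner ℂ (w : Z) p.2 = 0} := by
    ext p
    simp only [mem_iInter]
    exact h.mem_graph_restrictKer_iff
  rw [LinearPMap.IsClosed, graph_eq]
  exact isClosed_iInter fun w => isClosed_iInter fun _ =>
    isClosed_eq (by fun_prop) continuous_const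

theorem two_mul_re_inner_eq (h : IsScatteringTriple M Gp Gm) (z : M.domain) :
    2 * (inner ℂ (z : Z) (M z)).re = ‖Gp z‖ ^ 2 - ‖Gm z‖ ^ 2 := by
  have green_re := congrArg Complex.re (h.green z z)
  rw [Complex.add_re, ← inner_conj_symm, Complex.conj_re, inner_self_eq_norm_sq_to_K,
    inner_self_eq_norm_sq_to_K] at green_re
  rw [two_mul, green_re]
  norm_cast

theorem isDissipative_restrictKer (h : IsScatteringTriple M Gp Gm) :
    IsDissipative (restrictKer M Gp) := by
  intro x
  obtain ⟨z, hz, hzx, hMz⟩ := mem_graph_restrictKer.1 ((restrictKer M Gp).mem_graph x)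
  have re_inner_eq := h.two_mul_re_inner_eq z
  rw [hz, norm_zero] at re_inner_eq
  rw [← hzx, ← hMz]
  linarith [sq_nonneg ‖Gm z‖]

theorem exists_smul_sub_restrictKer_eq [CompleteSpace Z] (h : IsScatteringTriple M Gp Gm) {l : ℝ}
    (hl : 0 < l) (y : Z) :
    ∃ x : (restrictKer M Gp).domain, (l : ℂ) • (x : Z) - restrictKer M Gp x = y := by
  refine h.isDissipative_restrictKer.exists_smul_sub_eq h.isClosed_restrictKer hl
    (fun v hv => ?_) y
  have mem_graph : (v, (l : ℂ) • v) ∈ (restrictKer (-M) Gm).graph := by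
    rw [h.neg.mem_graph_restrictKer_iff]
    intro (z : M.domain) hz
    obtain ⟨x, hx, hMx⟩ :=
      (LinearPMap.mem_graph_iff _).1 (mem_graph_restrictKer.2 ⟨z, hz, rfl, rfl⟩)
    have orthogonal := hv x
    rw [hx, hMx, inner_sub_left, inner_smul_left, Complex.conj_ofReal] at orthogonal
    rw [LinearPMap.neg_apply, inner_neg_left, inner_smul_right]
    linear_combination orthogonal
  obtain ⟨x, rfl, hx⟩ := (LinearPMap.mem_graph_iff _).1 mem_graph
  exact h.neg.isDissipative_restrictKer.eq_zero_of_apply_eq_smul hl hx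

theorem generatesC0Semigroup [CompleteSpace Z] (h : IsScatteringTriple M Gp Gm) :
    (restrictKer M Gp).GeneratesC0Semigroup :=
  h.isDissipative_restrictKer.generatesC0Semigroup fun _ hl =>
    h.exists_smul_sub_restrictKer_eq hl

/-- A lift `w` of `b`, corrected by the solution `z ∈ ker Gm` of `z + M z = w + M w`, which exists
because `-M` restricted to `ker Gm` is maximal dissipative. -/
theorem exists_eigenvector [CompleteSpace Z] (h : IsScatteringTriple M Gp Gm) (b : W) :
    ∃ z : M.domain, M z = -(z : Z) ∧ Gm z = b := by
  obtain ⟨w, -, hw⟩ := h.surjective 0 b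
  obtain ⟨x, hx⟩ := h.neg.exists_smul_sub_restrictKer_eq one_pos ((w : Z) + M w)
  obtain ⟨z, hz, hzx, hMz⟩ := mem_graph_restrictKer.1 ((restrictKer (-M) Gm).mem_graph x)
  rw [← hzx, ← hMz, LinearPMap.neg_apply, Complex.ofReal_one, one_smul, sub_neg_eq_add] at hx
  refine ⟨w - (z : M.domain), ?_, ?_⟩
  · rw [LinearPMap.map_sub, Submodule.coe_sub, neg_sub, sub_eq_sub_iff_add_eq_add, add_comm, ← hx]
  · rw [map_sub, hz, hw, sub_zero]

end IsScatteringTriple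

end ScatteringTriple

section ScatteringColligation

variable {Z W V : Type*} [NormedAddCommGroup Z] [InnerProductSpace ℂ Z]
  [NormedAddCommGroup W] [InnerProductSpace ℂ W] [NormedAddCommGroup V] [InnerProductSpace ℂ V]
  {M : Z →ₗ.[ℂ] Z} {Gp Gm : M.domain →ₗ[ℂ] W} {P : W →L[ℂ] V}

/-- The colligation with input `Gp z`, interior operator `M` and output `-P (Gm z)`. -/
def scatteringColligation (Gp Gm : M.domain →ₗ[ℂ] W) (P : W →L[ℂ] V) : Colligation W Z V where
  dom := M.domain
  G := Gp
  L := M.toFun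
  K := -(P.toLinearMap ∘ₗ Gm)

theorem mem_graph_combined {v v' : Z} {a : W} {k : V} :
    (v, a, v', k) ∈ (scatteringColligation Gp Gm P).combined.graph ↔
      ∃ z : M.domain, (z : Z) = v ∧ Gp z = a ∧ M z = v' ∧ -P (Gm z) = k := by
  rw [LinearPMap.mem_graph_iff]
  exact exists_congr fun z =>
    and_congr Iff.rfl (Prod.ext_iff.trans (and_congr Iff.rfl Prod.ext_iff))

theorem isSmoothSolution_of_eigenvector {z : M.domain} (hz : M z = -(z : Z)) :
    (scatteringColligation Gp Gm P).IsSmoothSolution (fun t => (Real.exp (-t) : ℂ) • Gp z)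
      (fun t => ((Real.exp (-t) : ℂ) • z : M.domain))
      (fun t => (Real.exp (-t) : ℂ) • -P (Gm z)) := by
  have exp_contDiff {n : WithTop ℕ∞} : ContDiff ℝ n fun t : ℝ => (Real.exp (-t) : ℂ) :=
    Complex.ofRealCLM.contDiff.comp (Real.contDiff_exp.comp contDiff_neg)
  have exp_hasDerivAt (t : ℝ) :
      HasDerivAt (fun s : ℝ => (Real.exp (-s) : ℂ)) ((Real.exp (-t) * -1 : ℝ) : ℂ) t :=
    ((Real.hasDerivAt_exp _).comp t (hasDerivAt_neg t)).ofReal_comp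
  let K := (scatteringColligation Gp Gm P).K
  refine ⟨(exp_contDiff.smul contDiff_const).contDiffOn,
    (exp_contDiff.smul contDiff_const).contDiffOn, ?_, fun t _ => (Gp.map_smul _ z).symm,
    fun t _ => ?_, fun t _ => (K.map_smul _ z).symm⟩
  · have smul_continuous : Continuous fun t : ℝ => (Real.exp (-t) : ℂ) •
        ((z : Z), Gp z, M z, -P (Gm z)) := by fun_prop
    exact smul_continuous.continuousOn.congr fun t _ => Prod.ext rfl
      (Prod.ext (Gp.map_smul _ z) (Prod.ext (M.map_smul _ z) (K.map_smul _ z)))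
  · refine ((exp_hasDerivAt t).smul_const (z : Z)).hasDerivWithinAt.congr_deriv ?_
    change _ = M ((Real.exp (-t) : ℂ) • z)
    rw [M.map_smul, hz, mul_neg_one, Complex.ofReal_neg, neg_smul, smul_neg]

namespace IsScatteringTriple

/-- Testing against `w` with `Gm w = P† b` detects both the input `Gp z` and the output `-P (Gm z)`
through the Green identity. -/
theorem isClosed_combined [CompleteSpace W] [CompleteSpace V] (h : IsScatteringTriple M Gp Gm)
    (P : W →L[ℂ] V) : (scatteringColligation Gp Gm P).combined.IsClosed := by
  have graph_eq : ((scatteringColligation Gp Gm P).combined.graph : Set (Z × W × Z × V)) =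
      (fun p => (p.1, p.2.2.1)) ⁻¹' (M.graph : Set (Z × Z)) ∩
        ⋂ (w : M.domain) (b : V) (_ : Gm w = P.adjoint b),
          {p | inner ℂ (M w) p.1 + inner ℂ (w : Z) p.2.2.1 =
            inner ℂ (Gp w) p.2.1 + inner ℂ b p.2.2.2} := by
    ext ⟨v, a, v', k⟩
    have green (w z : M.domain) (b : V) (hw : Gm w = P.adjoint b) :
        inner ℂ (M w) (z : Z) + inner ℂ (w : Z) (M z) =
          inner ℂ (Gp w) (Gp z) - inner ℂ b (P (Gm z)) := by
      rw [h.green, hw, ContinuousLinearMap.adjoint_inner_left]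
    simp only [SetLike.mem_coe, mem_inter_iff, mem_preimage, mem_iInter, mem_ofPred_eq]
    constructor
    · intro hp
      obtain ⟨z, rfl, rfl, rfl, rfl⟩ := mem_graph_combined.1 hp
      refine ⟨M.mem_graph z, fun w b hw => ?_⟩
      rw [green w z b hw, inner_neg_right, sub_eq_add_neg]
    · rintro ⟨hv, hp⟩
      obtain ⟨z, rfl, rfl⟩ := (LinearPMap.mem_graph_iff M).1 hv
      have test (c : W) (b : V) :
          inner ℂ c (Gp z - a) - inner ℂ b (P (Gm z) + k) = 0 := by
        obtain ⟨w, rfl, hw⟩ := h.surjective c (P.adjoint b)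
        have hz := (green w z b hw).symm.trans (hp w b hw)
        rw [inner_sub_right, inner_add_right]
        linear_combination hz
      have input_eq : Gp z = a := by
        simpa only [inner_zero_left, sub_zero, inner_self_eq_zero, sub_eq_zero] using
          test (Gp z - a) 0
      have output_eq : -P (Gm z) = k := by
        simpa only [inner_zero_left, zero_sub, neg_eq_zero, inner_self_eq_zero,
          ← neg_eq_iff_add_eq_zero] using test 0 (P (Gm z) + k)
      exact mem_graph_combined.2 ⟨z, rfl, input_eq, rfl, output_eq⟩
  rw [LinearPMap.IsClosed, graph_eq]
  exact (IsClosed.preimage (by fun_prop) h.closed).inter <| isClosed_iInter fun w =>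
    isClosed_iInter fun b => isClosed_iInter fun _ => isClosed_eq (by fun_prop) (by fun_prop)

theorem power_balance (h : IsScatteringTriple M Gp Gm) {u : ℝ → W}
    {z : ℝ → (scatteringColligation Gp Gm P).dom} {y : ℝ → V}
    (hs : (scatteringColligation Gp Gm P).IsSmoothSolution u z y) {t : ℝ} (ht : 0 ≤ t) :
    derivWithin (fun s => ‖(z s : Z)‖ ^ 2) (Ici 0) t + ‖y t‖ ^ 2 =
      ‖u t‖ ^ 2 - (‖Gm (z t)‖ ^ 2 - ‖P (Gm (z t))‖ ^ 2) := by
  have hasDeriv : HasDerivWithinAt (fun s => (z s : Z)) (M (z t)) (Ici 0) t := hs.state_eq t ht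
  have hasDeriv_norm_sq : HasDerivWithinAt (fun s => ‖(z s : Z)‖ ^ 2)
      (‖Gp (z t)‖ ^ 2 - ‖Gm (z t)‖ ^ 2) (Ici 0) t := by
    let : InnerProductSpace ℝ Z := InnerProductSpace.rclikeToReal ℂ Z
    exact hasDeriv.norm_sq.congr_deriv (h.two_mul_re_inner_eq (z t))
  have input_norm : ‖u t‖ = ‖Gp (z t)‖ := congrArg norm (hs.input_eq t ht)
  have output_norm : ‖y t‖ = ‖P (Gm (z t))‖ :=
    (congrArg norm (hs.output_eq t ht)).trans (norm_neg _)
  rw [hasDeriv_norm_sq.derivWithin (uniqueDiffOn_Ici 0 t ht), input_norm, output_norm]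
  ring

variable [CompleteSpace Z]

theorem isInternallyWellPosed [CompleteSpace W] [CompleteSpace V]
    (h : IsScatteringTriple M Gp Gm) (P : W →L[ℂ] V) :
    (scatteringColligation Gp Gm P).IsInternallyWellPosed := by
  have dissipative := h.isDissipative_restrictKer
  have onto := h.exists_smul_sub_restrictKer_eq one_pos
  refine ⟨⟨h.isClosed_combined P, fun a => (h.surjective a 0).imp fun _ => And.left, ?_, ?_⟩,
    h.generatesC0Semigroup⟩
  · exact (dissipative.dense_domain one_pos onto).mono inter_subset_left
  · obtain ⟨R, hR, -⟩ := dissipative.exists_isResolventAt one_pos onto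
    exact ⟨_, R, hR.right_inv, hR.left_inv⟩

theorem exists_isSmoothSolution (h : IsScatteringTriple M Gp Gm) (P : W →L[ℂ] V) (g : W) :
    ∃ u, ∃ z : ℝ → (scatteringColligation Gp Gm P).dom, ∃ y,
      (scatteringColligation Gp Gm P).IsSmoothSolution u z y ∧ Gm (z 0) = g := by
  obtain ⟨z, hz, hg⟩ := h.exists_eigenvector g
  refine ⟨_, _, _, isSmoothSolution_of_eigenvector hz, ?_⟩
  rw [neg_zero, Real.exp_zero, Complex.ofReal_one, one_smul, hg]

theorem isScatteringPassive_iff [CompleteSpace W] [CompleteSpace V]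
    (h : IsScatteringTriple M Gp Gm) :
    (scatteringColligation Gp Gm P).IsScatteringPassive ↔ ‖P‖ ≤ 1 := by
  refine ⟨fun hp => P.opNorm_le_bound zero_le_one fun g => ?_, fun hP =>
    ⟨h.isInternallyWellPosed P, fun u z y hs t ht => ?_⟩⟩
  · obtain ⟨u, z, y, hs, rfl⟩ := h.exists_isSmoothSolution P g
    have dissipation := hp.2 _ _ _ hs 0 le_rfl
    rw [h.power_balance hs le_rfl, sub_le_self_iff, sub_nonneg] at dissipation
    rw [one_mul]
    exact le_of_sq_le_sq dissipation (norm_nonneg _)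
  · rw [h.power_balance hs ht, sub_le_self_iff, sub_nonneg]
    gcongr
    simpa only [one_mul] using P.le_of_opNorm_le hP (Gm (z t))

theorem isScatteringEnergyPreserving_iff [CompleteSpace W] [CompleteSpace V]
    (h : IsScatteringTriple M Gp Gm) :
    (scatteringColligation Gp Gm P).IsScatteringEnergyPreserving ↔ ∀ g, ‖P g‖ = ‖g‖ := by
  refine ⟨fun hp g => ?_, fun hP => ⟨h.isInternallyWellPosed P, fun u z y hs t ht => ?_⟩⟩
  · obtain ⟨u, z, y, hs, rfl⟩ := h.exists_isSmoothSolution P g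
    have conservation := hp.2 _ _ _ hs 0 le_rfl
    rw [h.power_balance hs le_rfl, sub_eq_self, sub_eq_zero] at conservation
    exact ((sq_eq_sq₀ (norm_nonneg _) (norm_nonneg _)).1 conservation).symm
  · rw [h.power_balance hs ht, hP, sub_self, sub_zero]

end IsScatteringTriple

end ScatteringColligation

section AntiDual

variable {E F : Type*} [NormedAddCommGroup E] [InnerProductSpace ℂ E]
  [NormedAddCommGroup F] [InnerProductSpace ℂ F]

theorem inner_rieszIso_left [CompleteSpace E] (x : E) (f : AntiDual E) :
    inner ℂ (rieszIso E x) f = f x := by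
  obtain ⟨y, rfl⟩ := (rieszIso E).surjective f
  rw [LinearIsometryEquiv.inner_map_map, rieszIso_apply]

theorem inner_rieszIso_right [CompleteSpace E] (x : E) (f : AntiDual E) :
    inner ℂ f (rieszIso E x) = conj (f x) :=
  (inner_conj_symm (𝕜 := ℂ) f _).symm.trans (congrArg conj (inner_rieszIso_left x f))

theorem antiDualProd_surjective :
    Function.Surjective (antiDualProd : AntiDual E × AntiDual F →ₗ[ℂ] _) := by
  intro f
  let e := (WithLp.prodContinuousLinearEquiv 2 ℂ E F).symm.toContinuousLinearMap
  refine ⟨(f.comp (e.comp (.inl ℂ E F)), f.comp (e.comp (.inr ℂ E F))), ?_⟩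
  ext x
  rw [antiDualProd_apply]
  change f (WithLp.toLp 2 (x.fst, 0)) + f (WithLp.toLp 2 (0, x.snd)) = f x
  rw [← map_add, ← WithLp.toLp_add, Prod.mk_add_mk, add_zero, zero_add]
  rfl

end AntiDual

section Polarization

theorem inner_smul_add_sub_inner_smul_sub {𝕜 W : Type*} [RCLike 𝕜] [NormedAddCommGroup W]
    [InnerProductSpace 𝕜 W] {c : 𝕜} (hc : c * c = 1 / 2) (conj_c : conj c = c) (a b a' b' : W) :
    inner 𝕜 (c • (a + b)) (c • (a' + b')) - inner 𝕜 (c • (a - b)) (c • (a' - b')) =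
      inner 𝕜 a b' + inner 𝕜 b a' := by
  simp only [inner_smul_left, inner_smul_right, inner_add_left, inner_add_right,
    inner_sub_left, inner_sub_right, conj_c]
  linear_combination (2 * (inner 𝕜 a b' + inner 𝕜 b a')) * hc

variable {𝕜 W : Type*} [Field 𝕜] [CharZero 𝕜] [AddCommGroup W] [Module 𝕜 W] {c : 𝕜}

theorem smul_smul_add_add_smul_sub (hc : c * c = 1 / 2) (a b : W) :
    c • (c • (a + b) + c • (a - b)) = a := by
  rw [← smul_add, smul_smul, hc, add_add_sub_cancel, ← two_smul 𝕜 a, smul_smul,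
    one_div_mul_cancel two_ne_zero, one_smul]

theorem smul_smul_add_sub_smul_sub (hc : c * c = 1 / 2) (a b : W) :
    c • (c • (a + b) - c • (a - b)) = b := by
  rw [← smul_sub, smul_smul, hc, add_sub_sub_cancel, ← two_smul 𝕜 b, smul_smul,
    one_div_mul_cancel two_ne_zero, one_smul]

end Polarization

namespace SecondOrderSystem

variable {X Y : Type*} [NormedAddCommGroup X] [InnerProductSpace ℂ X] [CompleteSpace X]
  [NormedAddCommGroup Y] [InnerProductSpace ℂ Y] [CompleteSpace Y] {D : SecondOrderSystem X Y}

theorem energyA_isometry : Isometry D.energyA :=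
  AddMonoidHomClass.isometry_of_norm _ fun _ => rfl

theorem exists_energyA_add_eq (y : Y) :
    ∃ z : D.EnergySpace, ∃ k ∈ (LinearMap.range D.energyA)ᗮ, D.energyA z + k = y := by
  have range_complete : CompleteSpace (LinearMap.range D.energyA) :=
    completeSpace_coe_iff_isComplete.2 D.energyA_isometry.isUniformInducing.isComplete_range
  obtain ⟨_, ⟨z, rfl⟩, k, hk, hy⟩ := (LinearMap.range D.energyA).exists_add_mem_mem_orthogonal y
  exact ⟨z, k, hk, hy.symm⟩

theorem graph_adjoint_A_le : D.A.graph.adjoint ≤ (-D.B).graph := by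
  rw [← LinearPMap.adjoint_graph_eq_graph_adjoint D.A_dense]
  exact LinearPMap.le_graph_of_le D.dualPair

theorem inner_A_eq_zero {k : Y} (hk : k ∈ (LinearMap.range D.energyA)ᗮ) (x : D.A.domain) :
    inner ℂ (D.A x) k = 0 :=
  hk _ ⟨D.toDom.symm x, rfl⟩

theorem mem_graph_B_of_mem_orthogonal {k : Y} (hk : k ∈ (LinearMap.range D.energyA)ᗮ) :
    (k, 0) ∈ D.B.graph := by
  rw [← neg_zero, ← mem_graph_neg]
  refine D.graph_adjoint_A_le ((Submodule.mem_adjoint_iff _ _).2 fun a b hab => ?_)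
  obtain ⟨x, rfl, rfl⟩ := (LinearPMap.mem_graph_iff _).1 hab
  rw [inner_zero_right, sub_zero]
  exact inner_A_eq_zero hk x

theorem mem_graph_maxOperator {z w : D.StateSpace} :
    (z, w) ∈ D.maxOperator.graph ↔
      (z.snd, D.energyA w.fst) ∈ D.A.graph ∧ (D.energyA z.fst, w.snd) ∈ D.B.graph := by
  constructor
  · intro h
    obtain ⟨z, rfl, rfl⟩ := (LinearPMap.mem_graph_iff _).1 h
    exact ⟨D.A.mem_graph (D.velocity z), D.B.mem_graph (D.strain z)⟩
  · rintro ⟨hA, hB⟩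
    obtain ⟨x, hx, hAx⟩ := (LinearPMap.mem_graph_iff _).1 hA
    obtain ⟨y, hy, hBy⟩ := (LinearPMap.mem_graph_iff _).1 hB
    let z' : D.maxDomain :=
      ⟨z, LinearPMap.mem_domain_of_mem_graph hB, LinearPMap.mem_domain_of_mem_graph hA⟩
    have velocity_eq : D.velocity z' = x := Subtype.ext hx.symm
    have strain_eq : D.strain z' = y := Subtype.ext hy.symm
    have fst_eq : D.toDom.symm x = w.fst := D.energyA_injective hAx
    refine (LinearPMap.mem_graph_iff _).2 ⟨z', rfl, ?_⟩
    change D.maxOperator z' = w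
    rw [maxOperator_apply, velocity_eq, strain_eq, fst_eq, hBy]
    rfl

theorem maxOperator_isClosed : D.maxOperator.IsClosed := by
  have energyA_continuous : Continuous D.energyA := D.energyA_isometry.continuous
  have graph_eq : (D.maxOperator.graph : Set (D.StateSpace × D.StateSpace)) =
      (fun p => (p.1.snd, D.energyA p.2.fst)) ⁻¹' (D.A.graph : Set (X × Y)) ∩
        (fun p => (D.energyA p.1.fst, p.2.snd)) ⁻¹' (D.B.graph : Set (Y × X)) :=
    Set.ext fun _ => D.mem_graph_maxOperator
  rw [LinearPMap.IsClosed, graph_eq]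
  exact (D.A_closed.preimage (by fun_prop)).inter (D.B_closed.preimage (by fun_prop))

section Adjoint

variable {w w' : D.StateSpace}

theorem inner_eq_of_mem_adjoint (h : (w, w') ∈ D.maxOperator.graph.adjoint)
    {z₁ v₁ : D.EnergySpace} {z₂ v₂ : X} (hA : (z₂, D.energyA v₁) ∈ D.A.graph)
    (hB : (D.energyA z₁, v₂) ∈ D.B.graph) :
    inner ℂ v₁ w.fst + inner ℂ v₂ w.snd = inner ℂ z₁ w'.fst + inner ℂ z₂ w'.snd :=
  sub_eq_zero.1 <| (Submodule.mem_adjoint_iff _ _).1 h (WithLp.toLp 2 (z₁, z₂))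
    (WithLp.toLp 2 (v₁, v₂)) (D.mem_graph_maxOperator.2 ⟨hA, hB⟩)

theorem mem_graph_A_of_mem_adjoint (h : (w, w') ∈ D.maxOperator.graph.adjoint) :
    (w.snd, -D.energyA w'.fst) ∈ D.A.graph := by
  rw [← adjoint_adjoint_of_isClosed D.A_closed, Submodule.mem_adjoint_iff]
  intro y y' hy
  obtain ⟨z, k, hk, rfl⟩ := D.exists_energyA_add_eq y
  have mem_graph_B : (D.energyA z, -y') ∈ D.B.graph := by
    have mem_sub := sub_mem (mem_graph_neg.1 (D.graph_adjoint_A_le hy))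
      (D.mem_graph_B_of_mem_orthogonal hk)
    rwa [Prod.mk_sub_mk, add_sub_cancel_right, sub_zero] at mem_sub
  have weak_eq := inner_eq_of_mem_adjoint h (z₂ := 0) (v₁ := 0)
    (by rw [map_zero]; exact zero_mem _) mem_graph_B
  rw [inner_zero_left, inner_zero_left, zero_add, add_zero, inner_neg_left] at weak_eq
  have energy_eq : inner ℂ z w'.fst = inner ℂ (D.energyA z) (D.energyA w'.fst) := rfl
  have orthogonal : inner ℂ k (D.energyA w'.fst) = 0 :=
    Submodule.inner_left_of_mem_orthogonal (LinearMap.mem_range_self _ _) hk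
  rw [inner_neg_right, inner_add_left, orthogonal]
  linear_combination -weak_eq - energy_eq

theorem mem_graph_B_of_mem_adjoint (h : (w, w') ∈ D.maxOperator.graph.adjoint) :
    (D.energyA w.fst, -w'.snd) ∈ D.B.graph := by
  refine mem_graph_neg.1 (D.graph_adjoint_A_le ((Submodule.mem_adjoint_iff _ _).2 ?_))
  intro a b hab
  obtain ⟨x, rfl, rfl⟩ := (LinearPMap.mem_graph_iff _).1 hab
  have weak_eq := inner_eq_of_mem_adjoint h (z₁ := 0) (v₁ := D.toDom.symm x) (v₂ := 0)
    (D.A.mem_graph x) (by rw [map_zero]; exact zero_mem _)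
  rw [inner_zero_left, inner_zero_left, zero_add, add_zero] at weak_eq
  exact sub_eq_zero.2 weak_eq

theorem graph_adjoint_maxOperator_le : D.maxOperator.graph.adjoint ≤ (-D.maxOperator).graph := by
  rintro ⟨w, w'⟩ h
  refine mem_graph_neg.2 (D.mem_graph_maxOperator.2 ⟨?_, mem_graph_B_of_mem_adjoint h⟩)
  change (w.snd, D.energyA (-w'.fst)) ∈ D.A.graph
  rw [map_neg]
  exact mem_graph_A_of_mem_adjoint h

end Adjoint

namespace BoundaryTriplet

variable {G₁ G₂ : Type*} [NormedAddCommGroup G₁] [InnerProductSpace ℂ G₁]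
  [NormedAddCommGroup G₂] [InnerProductSpace ℂ G₂] (T : D.BoundaryTriplet G₁ G₂)

theorem inner_maxOperator_add_inner (z w : D.maxDomain) :
    inner ℂ (D.maxOperator z) (w : D.StateSpace) + inner ℂ (z : D.StateSpace) (D.maxOperator w) =
      T.Γ₁ w (T.Γ₀ z) + conj (T.Γ₁ z (T.Γ₀ w)) := by
  have Γ₁_apply_Γ₀ (z w : D.maxDomain) : T.Γ₁ w (T.Γ₀ z) =
      -T.Pi₁ (D.strain w) (T.Λ₁ (D.velocity z)) + T.Λ₂ (D.velocity w) (T.Pi₂ (D.strain z)) := rfl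
  have green_left := T.green (D.strain w) (D.velocity z)
  have green_right := congrArg conj (T.green (D.strain z) (D.velocity w))
  rw [Γ₁_apply_Γ₀, Γ₁_apply_Γ₀, WithLp.prod_inner_apply, WithLp.prod_inner_apply]
  simp only [map_sub, map_neg, map_add, inner_conj_symm, Complex.conj_conj] at green_right ⊢
  change inner ℂ (D.A (D.velocity z)) (D.strain w : Y) +
    inner ℂ (D.B (D.strain z)) (D.velocity w : X) +
    (inner ℂ (D.strain z : Y) (D.A (D.velocity w)) +
      inner ℂ (D.velocity z : X) (D.B (D.strain w))) = _
  linear_combination -green_left - green_right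

variable [CompleteSpace G₂]

theorem Pi_eq_zero {k : D.B.domain} (hBk : D.B k = 0)
    (hk : (k : Y) ∈ (LinearMap.range D.energyA)ᗮ) : T.Pi₁ k = 0 ∧ T.Pi₂ k = 0 := by
  have pairing_eq {g₁ g₂ x} (hx : (T.Λ₁ x, T.Λ₂ x) = (g₁, g₂)) :
      T.Pi₁ k g₁ = conj (g₂ (T.Pi₂ k)) := by
    obtain ⟨rfl, rfl⟩ := Prod.mk.inj hx
    rw [← sub_eq_zero, ← T.green, hBk, inner_A_eq_zero hk, inner_zero_right, neg_zero, sub_zero]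
  constructor
  · ext g
    obtain ⟨x, hx⟩ := T.surjective_Λ (g, 0)
    rw [pairing_eq hx, zero_apply, zero_apply, map_zero]
  · obtain ⟨x, hx⟩ := T.surjective_Λ (0, rieszIso G₂ (T.Pi₂ k))
    have inner_self := pairing_eq hx
    rwa [map_zero, rieszIso_apply, inner_conj_symm, eq_comm, inner_self_eq_zero] at inner_self

theorem exists_energyA_eq_and_Pi_eq (y : D.B.domain) : ∃ z : D.EnergySpace, ∃ y' : D.B.domain,
    D.energyA z = y' ∧ T.Pi₁ y' = T.Pi₁ y ∧ T.Pi₂ y' = T.Pi₂ y := by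
  obtain ⟨z, k, hk, hy⟩ := D.exists_energyA_add_eq (y : Y)
  obtain ⟨k, rfl, hBk⟩ :=
    (LinearPMap.mem_graph_iff _).1 (D.mem_graph_B_of_mem_orthogonal hk)
  obtain ⟨hPi₁, hPi₂⟩ := T.Pi_eq_zero hBk hk
  refine ⟨z, y - k, eq_sub_of_add_eq hy, ?_, ?_⟩
  · rw [map_sub, hPi₁, sub_zero]
  · rw [map_sub, hPi₂, sub_zero]

theorem exists_Γ_eq (g : WithLp 2 (G₁ × G₂)) (f : AntiDual (WithLp 2 (G₁ × G₂))) :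
    ∃ z, T.Γ₀ z = g ∧ T.Γ₁ z = f := by
  obtain ⟨⟨f₁, f₂⟩, rfl⟩ := antiDualProd_surjective f
  obtain ⟨x, hx⟩ := T.surjective_Λ (g.fst, f₂)
  obtain ⟨y, hy⟩ := T.surjective_Pi (-f₁, g.snd)
  obtain ⟨hΛ₁, hΛ₂⟩ := Prod.mk.inj hx
  obtain ⟨hPi₁, hPi₂⟩ := Prod.mk.inj hy
  obtain ⟨z₁, y', hz₁, hPi₁', hPi₂'⟩ := T.exists_energyA_eq_and_Pi_eq y
  have strain_mem : D.energyA z₁ ∈ D.B.domain := hz₁ ▸ y'.2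
  let z : D.maxDomain := ⟨WithLp.toLp 2 (z₁, (x : X)), strain_mem, x.2⟩
  have velocity_eq : D.velocity z = x := rfl
  have strain_eq : D.strain z = y' := Subtype.ext hz₁
  refine ⟨z, ?_, ?_⟩
  · change WithLp.toLp 2 (T.Λ₁ (D.velocity z), T.Pi₂ (D.strain z)) = g
    rw [velocity_eq, strain_eq, hΛ₁, hPi₂', hPi₂]
    rfl
  · change antiDualProd (-T.Pi₁ (D.strain z), T.Λ₂ (D.velocity z)) = antiDualProd (f₁, f₂)
    rw [velocity_eq, strain_eq, hΛ₂, hPi₁', hPi₁, neg_neg]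

variable [CompleteSpace G₁]

/-- The incoming wave `(1/√2) (R Γ₀ + Γ₁)`, the input of the colligation. -/
def incoming : D.maxOperator.domain →ₗ[ℂ] AntiDual (WithLp 2 (G₁ × G₂)) :=
  (1 / ((√2 : ℝ) : ℂ)) • (T.rieszΓ₀ + T.Γ₁)

/-- The outgoing wave `(1/√2) (R Γ₀ - Γ₁)`, which `-P` maps to the output of the colligation. -/
def outgoing : D.maxOperator.domain →ₗ[ℂ] AntiDual (WithLp 2 (G₁ × G₂)) :=
  (1 / ((√2 : ℝ) : ℂ)) • (T.rieszΓ₀ - T.Γ₁)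

theorem isScatteringTriple : IsScatteringTriple D.maxOperator T.incoming T.outgoing := by
  set c : ℂ := 1 / ((√2 : ℝ) : ℂ)
  have c_mul_self : c * c = 1 / 2 := by
    rw [div_mul_div_comm, one_mul, ← Complex.ofReal_mul, Real.mul_self_sqrt zero_le_two,
      Complex.ofReal_ofNat]
  have conj_c : conj c = c := by rw [map_div₀, map_one, Complex.conj_ofReal]
  let R := rieszIso (WithLp 2 (G₁ × G₂))
  refine ⟨D.maxOperator_isClosed, D.graph_adjoint_maxOperator_le, fun a b => ?_, fun z w => ?_⟩
  · obtain ⟨z, hΓ₀, hΓ₁⟩ := T.exists_Γ_eq (R.symm (c • (a + b))) (c • (a - b))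
    have rieszΓ₀_eq : T.rieszΓ₀ z = c • (a + b) :=
      (congrArg R hΓ₀).trans (R.apply_symm_apply _)
    refine ⟨z, ?_, ?_⟩
    · change c • (T.rieszΓ₀ z + T.Γ₁ z) = a
      rw [rieszΓ₀_eq, hΓ₁, smul_smul_add_add_smul_sub c_mul_self]
    · change c • (T.rieszΓ₀ z - T.Γ₁ z) = b
      rw [rieszΓ₀_eq, hΓ₁, smul_smul_add_sub_smul_sub c_mul_self]
  · refine (T.inner_maxOperator_add_inner z w).trans ?_
    rw [← inner_rieszIso_left, ← inner_rieszIso_right]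
    exact (inner_smul_add_sub_inner_smul_sub c_mul_self conj_c (T.rieszΓ₀ z) (T.Γ₁ z)
      (T.rieszΓ₀ w) (T.Γ₁ w)).symm

theorem colligation_eq_scatteringColligation
    (P : AntiDual (WithLp 2 (G₁ × G₂)) →L[ℂ] AntiDual (WithLp 2 (G₁ × G₂))) :
    T.colligation P = scatteringColligation T.incoming T.outgoing P := by
  have output_eq :
      (T.colligation P).K = (scatteringColligation T.incoming T.outgoing P).K := by
    ext1 z
    change (-1 / ((√2 : ℝ) : ℂ)) • P (T.rieszΓ₀ z - T.Γ₁ z) =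
      -P ((1 / ((√2 : ℝ) : ℂ)) • (T.rieszΓ₀ z - T.Γ₁ z))
    rw [map_smul, neg_div]
    exact neg_smul (1 / ((√2 : ℝ) : ℂ)) (P (T.rieszΓ₀ z - T.Γ₁ z))
  change Colligation.mk _ _ _ (T.colligation P).K = _
  rw [output_eq]
  rfl

end BoundaryTriplet

end SecondOrderSystem

theorem mem_unitary_iff_norm_map_and_surjective {𝕜 H : Type*} [RCLike 𝕜] [NormedAddCommGroup H]
    [InnerProductSpace 𝕜 H] [CompleteSpace H] {P : H →L[𝕜] H} :
    P ∈ unitary (H →L[𝕜] H) ↔ (∀ g, ‖P g‖ = ‖g‖) ∧ Function.Surjective P := by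
  have star_mul_self_iff : star P * P = 1 ↔ ∀ g, ‖P g‖ = ‖g‖ :=
    P.norm_map_iff_adjoint_comp_self.symm
  rw [Unitary.mem_iff, star_mul_self_iff]
  refine and_congr_right fun norm_map => ⟨fun mul_star_self g => ?_, fun surjective => ?_⟩
  · exact ⟨star P g, DFunLike.congr_fun mul_star_self g⟩
  · ext g
    obtain ⟨x, rfl⟩ := surjective g
    exact congrArg P (DFunLike.congr_fun (star_mul_self_iff.2 norm_map) x)

end

theorem theorem3p5 {X Y G₁ G₂ : Type*}
    [NormedAddCommGroup X] [InnerProductSpace ℂ X] [CompleteSpace X]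
    [NormedAddCommGroup Y] [InnerProductSpace ℂ Y] [CompleteSpace Y]
    [NormedAddCommGroup G₁] [InnerProductSpace ℂ G₁] [CompleteSpace G₁]
    [NormedAddCommGroup G₂] [InnerProductSpace ℂ G₂] [CompleteSpace G₂]
    (D : SecondOrderSystem X Y) (T : D.BoundaryTriplet G₁ G₂)
    (P : AntiDual (WithLp 2 (G₁ × G₂)) →L[ℂ] AntiDual (WithLp 2 (G₁ × G₂))) :
    D.minOperator.adjoint = D.maxOperator ∧
    ((T.colligation P).IsScatteringPassive ↔ ‖P‖ ≤ 1) ∧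
    ((T.colligation P).IsScatteringEnergyPreserving ↔ ∀ g, ‖P g‖ = ‖g‖) ∧
    (P ∈ unitary (AntiDual (WithLp 2 (G₁ × G₂)) →L[ℂ] AntiDual (WithLp 2 (G₁ × G₂))) ↔
      (T.colligation P).IsScatteringEnergyPreserving ∧ Function.Surjective P) ∧
    (FiniteDimensional ℂ (WithLp 2 (G₁ × G₂)) →
      ((T.colligation P).IsScatteringEnergyPreserving ↔
        P ∈ unitary (AntiDual (WithLp 2 (G₁ × G₂)) →L[ℂ] AntiDual (WithLp 2 (G₁ × G₂))))) := by
  have h := T.isScatteringTriple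
  rw [T.colligation_eq_scatteringColligation, h.isScatteringPassive_iff,
    h.isScatteringEnergyPreserving_iff, mem_unitary_iff_norm_map_and_surjective]
  refine ⟨adjoint_adjoint_of_isClosed_of_dense h.closed h.dense_domain, Iff.rfl, Iff.rfl, Iff.rfl,
    fun _ => ⟨fun norm_map => ⟨norm_map, ?_⟩, And.left⟩⟩
  have : FiniteDimensional ℂ (AntiDual (WithLp 2 (G₁ × G₂))) :=
    (rieszIso (WithLp 2 (G₁ × G₂))).toLinearEquiv.finiteDimensional
  exact LinearMap.surjective_of_injective (f := P.toLinearMap)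
    (AddMonoidHomClass.isometry_of_norm P norm_map).injective
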